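/- For real numbers $m,l$ let $F=1+m(x^2+y^2)$ and let the BCV space $M^3(m,l)$ be the domain $\{F>0\}\subset\mathbb{R}^3$ with the Riemannian metric $$h=\frac{dx^2+dy^2}{F^2}+\Big(dz+\frac{l}{2}\,\frac{y\,dx-x\,dy}{F}\Big)^2 .$$ The map $\pi(x,y,z)=(x,y)$ is a Riemannian submersion onto $B=(\{F>0\}\subset\mathbb{R}^2,\ (dx^2+dy^2)/F^2)$. As usual, $M^3(m,l)$ is called (locally) - $\mathbb{R}^3$ if $m=l=0$; - $S^2\times\mathbb{R}$ if $m>0$, $l=0$; - $H^2\times\mathbb{R}$ if $m<0$, $l=0$; - $S^3$ if $m>0$, $l^2=4m$; - $SU(2)$ if $m>0$, $l\neq0$, $l^2\neq4m$; - $\widetilde{SL}(2,\mathbb{R})$ if $m<0$, $l\neq0$; - $Nil$ if $m=0$, $l\neq0$. Let $\gamma=(x,y):I\to B$ be a smooth curve parametrized by arclength on an open interval $I$. Its Hopf cylinder is the surface $\pi^{-1}(\gamma(I))$, parametrized by $\varphi(s,z)=(x(s),y(s),z)$, $(s,z)\in I\times\mathbb{R}$. A proper biharmonic conformal immersion of the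 Hopf cylinder into $M^3(m,l)$ is a map $\varphi:(U,f^{-1}\varphi^*h)\to (M^3(m,l),h)$, where $U$ is $I\times\mathbb{R}$ or any open subset of it and $f:U\to(0,\infty)$ is any smooth function (constants allowed; the conformal factor is $f^{1/2}$), that is biharmonic but not harmonic. Here a map $\varphi:(M,g)\to(N,h)$ is harmonic if its tension field $\tau(\varphi)=\mathrm{Trace}_g\nabla d\varphi$ vanishes identically, and biharmonic if $$\tau_2(\varphi)=\mathrm{Trace}_g\big(\nabla^\varphi\nabla^\varphi-\nabla^\varphi_{\nabla^M}\big)\tau(\varphi)-\mathrm{Trace}_g R^N(d\varphi,\tau(\varphi))\,d\varphi$$ vanishes identically, where $R^N(X,Y)Z=[\nabla_X,\nabla_Y]Z-\nabla_{[X,Y]}Z$. Then: (i) If some Hopf cylinder admits a proper biharmonic conformal immersion into $M^3(m,l)$, then $M^3(m,l)$ is $S^2\times\mathbb{R}$, $H^2\times\mathbb{R}$, $\mathbb{R}^3$ or $SU(2)$. (ii) There is no proper biharmonic conformal immersion of a Hopf cylinder into $S^3$, $\widetilde{SL}(2,\mathbb{R})$ or $Nil$, whatever the conformal factor. -/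

import Mathlib

open scoped ContDiff Matrix

namespace BCV

/-! ### Riemannian geometry in coordinates

Points of a coordinate domain are vectors `Fin n → ℝ`.  A Riemannian metric is given by its
matrix of components `G p i j = ⟨∂ᵢ, ∂ⱼ⟩`, and a map by its component functions.  All
formulas below are only used on open sets where the metrics are smooth and positive definite. -/

/-- The partial derivative `∂ᵢ u` at `p`. -/
noncomputable def pd {n : ℕ} (i : Fin n) (u : (Fin n → ℝ) → ℝ) (p : Fin n → ℝ) : ℝ :=
  fderiv ℝ u p (Pi.single i 1)

/-- The Christoffel symbol `Γᵏᵢⱼ` of the Levi-Civita connection of the metric `G`. -/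
noncomputable def christoffel {n : ℕ} (G : (Fin n → ℝ) → Matrix (Fin n) (Fin n) ℝ)
    (k i j : Fin n) (p : Fin n → ℝ) : ℝ :=
  (1 / 2) * ∑ a, (G p)⁻¹ k a *
    (pd i (fun q => G q a j) p + pd j (fun q => G q a i) p - pd a (fun q => G q i j) p)

/-- The component `Rᵃ` of the curvature operator: `R(∂_c, ∂_d) ∂_b = ∑ₐ (curvature G a b c d) ∂ₐ`,
with the convention `R(X, Y) Z = ∇_X ∇_Y Z - ∇_Y ∇_X Z - ∇_[X, Y] Z`. -/
noncomputable def curvature {n : ℕ} (G : (Fin n → ℝ) → Matrix (Fin n) (Fin n) ℝ)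
    (a b c d : Fin n) (p : Fin n → ℝ) : ℝ :=
  pd c (christoffel G a d b) p - pd d (christoffel G a c b) p
    + ∑ e, (christoffel G a c e p * christoffel G e d b p
      - christoffel G a d e p * christoffel G e c b p)

/-- The components of the pull-back metric `φ^* h`. -/
noncomputable def pullbackMetric {k n : ℕ} (h : (Fin n → ℝ) → Matrix (Fin n) (Fin n) ℝ)
    (φ : (Fin k → ℝ) → (Fin n → ℝ)) (p : Fin k → ℝ) : Matrix (Fin k) (Fin k) ℝ :=
  Matrix.of fun i j =>
    ∑ a, ∑ b, h (φ p) a b * pd i (fun q => φ q a) p * pd j (fun q => φ q b) p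

/-- The pull-back connection `∇^φ_{∂ᵢ} W` on vector fields `W` along `φ : M → (N, h)`. -/
noncomputable def covDeriv {k n : ℕ} (h : (Fin n → ℝ) → Matrix (Fin n) (Fin n) ℝ)
    (φ : (Fin k → ℝ) → (Fin n → ℝ)) (i : Fin k) (W : (Fin k → ℝ) → (Fin n → ℝ))
    (p : Fin k → ℝ) : Fin n → ℝ :=
  fun a => pd i (fun q => W q a) p
    + ∑ b, ∑ c, christoffel h a b c (φ p) * pd i (fun q => φ q b) p * W p c

/-- The tension field `τ(φ) = Trace_g ∇dφ` of `φ : (M, g) → (N, h)`; here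
`(∇dφ)(∂ᵢ, ∂ⱼ) = ∇^φ_{∂ᵢ} (dφ ∂ⱼ) - dφ (∇^M_{∂ᵢ} ∂ⱼ)`. -/
noncomputable def tension {k n : ℕ} (g : (Fin k → ℝ) → Matrix (Fin k) (Fin k) ℝ)
    (h : (Fin n → ℝ) → Matrix (Fin n) (Fin n) ℝ) (φ : (Fin k → ℝ) → (Fin n → ℝ))
    (p : Fin k → ℝ) : Fin n → ℝ :=
  fun a => ∑ i, ∑ j, (g p)⁻¹ i j *
    (covDeriv h φ i (fun q b => pd j (fun r => φ r b) q) p a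
      - ∑ l, christoffel g l i j p * pd l (fun q => φ q a) p)

/-- The rough Laplacian `Trace_g (∇^φ ∇^φ - ∇^φ_{∇^M}) W` of a vector field `W` along `φ`. -/
noncomputable def roughLaplacian {k n : ℕ} (g : (Fin k → ℝ) → Matrix (Fin k) (Fin k) ℝ)
    (h : (Fin n → ℝ) → Matrix (Fin n) (Fin n) ℝ) (φ : (Fin k → ℝ) → (Fin n → ℝ))
    (W : (Fin k → ℝ) → (Fin n → ℝ)) (p : Fin k → ℝ) : Fin n → ℝ :=
  fun a => ∑ i, ∑ j, (g p)⁻¹ i j *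
    (covDeriv h φ i (covDeriv h φ j W) p a
      - ∑ l, christoffel g l i j p * covDeriv h φ l W p a)

/-- The trace `Trace_g R^N(dφ, W) dφ`. -/
noncomputable def curvatureTrace {k n : ℕ} (g : (Fin k → ℝ) → Matrix (Fin k) (Fin k) ℝ)
    (h : (Fin n → ℝ) → Matrix (Fin n) (Fin n) ℝ) (φ : (Fin k → ℝ) → (Fin n → ℝ))
    (W : (Fin k → ℝ) → (Fin n → ℝ)) (p : Fin k → ℝ) : Fin n → ℝ :=
  fun a => ∑ i, ∑ j, (g p)⁻¹ i j * ∑ b, ∑ c, ∑ d, curvature h a b c d (φ p) *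
    pd i (fun q => φ q c) p * W p d * pd j (fun q => φ q b) p

/-- The bitension field
`τ₂(φ) = Trace_g (∇^φ ∇^φ - ∇^φ_{∇^M}) τ(φ) - Trace_g R^N(dφ, τ(φ)) dφ`. -/
noncomputable def bitension {k n : ℕ} (g : (Fin k → ℝ) → Matrix (Fin k) (Fin k) ℝ)
    (h : (Fin n → ℝ) → Matrix (Fin n) (Fin n) ℝ) (φ : (Fin k → ℝ) → (Fin n → ℝ))
    (p : Fin k → ℝ) : Fin n → ℝ :=
  fun a => roughLaplacian g h φ (tension g h φ) p a - curvatureTrace g h φ (tension g h φ) p a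

/-- `φ : (U, g) → (N, h)` is harmonic: its tension field vanishes identically. -/
def IsHarmonicOn {k n : ℕ} (g : (Fin k → ℝ) → Matrix (Fin k) (Fin k) ℝ)
    (h : (Fin n → ℝ) → Matrix (Fin n) (Fin n) ℝ) (φ : (Fin k → ℝ) → (Fin n → ℝ))
    (U : Set (Fin k → ℝ)) : Prop :=
  ∀ p ∈ U, tension g h φ p = 0

/-- `φ : (U, g) → (N, h)` is biharmonic: its bitension field vanishes identically. -/
def IsBiharmonicOn {k n : ℕ} (g : (Fin k → ℝ) → Matrix (Fin k) (Fin k) ℝ)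
    (h : (Fin n → ℝ) → Matrix (Fin n) (Fin n) ℝ) (φ : (Fin k → ℝ) → (Fin n → ℝ))
    (U : Set (Fin k → ℝ)) : Prop :=
  ∀ p ∈ U, bitension g h φ p = 0

/-- Proper biharmonic maps: biharmonic maps that are not harmonic. -/
def IsProperBiharmonicOn {k n : ℕ} (g : (Fin k → ℝ) → Matrix (Fin k) (Fin k) ℝ)
    (h : (Fin n → ℝ) → Matrix (Fin n) (Fin n) ℝ) (φ : (Fin k → ℝ) → (Fin n → ℝ))
    (U : Set (Fin k → ℝ)) : Prop :=
  IsBiharmonicOn g h φ U ∧ ¬ IsHarmonicOn g h φ U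

/-! ### Bianchi-Cartan-Vranceanu spaces and their Hopf cylinders -/

/-- The function `F = 1 + m (x² + y²)`. -/
def factor (m x y : ℝ) : ℝ := 1 + m * (x ^ 2 + y ^ 2)

/-- The orthonormal coframe of the BCV space `M³(m, l)`; its rows are
`dx / F`, `dy / F` and `dz + (l / 2) (y dx - x dy) / F`. -/
noncomputable def bcvCoframe (m l : ℝ) (p : Fin 3 → ℝ) : Matrix (Fin 3) (Fin 3) ℝ :=
  !![1 / factor m (p 0) (p 1), 0, 0;
     0, 1 / factor m (p 0) (p 1), 0;
     (l / 2) * (p 1 / factor m (p 0) (p 1)), -((l / 2) * (p 0 / factor m (p 0) (p 1))), 1]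

/-- The metric `(dx² + dy²) / F² + (dz + (l / 2) (y dx - x dy) / F)²` of the BCV space
`M³(m, l)`, which lives on the set of all `(x, y, z)` with `F > 0`. -/
noncomputable def bcvMetric (m l : ℝ) (p : Fin 3 → ℝ) : Matrix (Fin 3) (Fin 3) ℝ :=
  (bcvCoframe m l p)ᵀ * bcvCoframe m l p

/-- `γ = (x, y) : I → B` is a smooth curve parametrized by arclength on an open interval `I`,
where `B` is the set `F > 0` of the plane with the metric `(dx² + dy²) / F²`. -/
structure IsBaseCurve (m : ℝ) (I : Set ℝ) (x y : ℝ → ℝ) : Prop where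
  isOpen : IsOpen I
  ordConnected : I.OrdConnected
  smooth_x : ContDiffOn ℝ ∞ x I
  smooth_y : ContDiffOn ℝ ∞ y I
  mem_base : ∀ s ∈ I, 0 < factor m (x s) (y s)
  unit_speed : ∀ s ∈ I,
    (deriv x s ^ 2 + deriv y s ^ 2) / factor m (x s) (y s) ^ 2 = 1

/-- The Hopf cylinder `φ(s, z) = (γ(s), z)` over `γ = (x, y)`, that is, the preimage of `γ` under
the Riemannian submersion `π(x, y, z) = (x, y)`. -/
def hopfCylinder (x y : ℝ → ℝ) (p : Fin 2 → ℝ) : Fin 3 → ℝ :=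
  ![x (p 0), y (p 0), p 1]

/-- The data `(I, γ = (x, y), U, f)` describe a proper biharmonic conformal immersion
`φ : (U, f⁻¹ φ^* h) → M³(m, l)` of (the open piece `U` of) the Hopf cylinder over `γ : I → B`;
the whole cylinder is the case `U = I × ℝ`.  The conformal factor `f^(1/2)` is an arbitrary
positive smooth function, and may be constant. -/
structure IsProperBiharmonicConformalHopfCylinder (m l : ℝ) (I : Set ℝ) (x y : ℝ → ℝ)
    (U : Set (Fin 2 → ℝ)) (f : (Fin 2 → ℝ) → ℝ) : Prop where
  baseCurve : IsBaseCurve m I x y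
  isOpen : IsOpen U
  subset : U ⊆ {p | p 0 ∈ I}
  smooth : ContDiffOn ℝ ∞ f U
  pos : ∀ p ∈ U, 0 < f p
  properBiharmonic : IsProperBiharmonicOn
    (fun p => (f p)⁻¹ • pullbackMetric (bcvMetric m l) (hopfCylinder x y) p)
    (bcvMetric m l) (hopfCylinder x y) U

/-- There is a proper biharmonic conformal immersion of a Hopf cylinder into `M³(m, l)`. -/
def AdmitsProperBiharmonicConformalHopfCylinder (m l : ℝ) : Prop :=
  ∃ (I : Set ℝ) (x y : ℝ → ℝ) (U : Set (Fin 2 → ℝ)) (f : (Fin 2 → ℝ) → ℝ),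
    IsProperBiharmonicConformalHopfCylinder m l I x y U f

/-! ### The model spaces among the BCV spaces

The base surface has constant Gauss curvature `4 m`, and the horizontal distribution has constant
bundle curvature, proportional to `l`; the following seven cases exhaust the family. -/

/-- `M³(m, l)` is (an open part of) `S² × ℝ`: the base is a sphere, and the metric a product. -/
def IsS2R (m l : ℝ) : Prop := 0 < m ∧ l = 0

/-- `M³(m, l)` is `H² × ℝ`: the base is a hyperbolic plane, and the metric a product. -/
def IsH2R (m l : ℝ) : Prop := m < 0 ∧ l = 0

/-- `M³(m, l)` is Euclidean space `ℝ³`. -/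
def IsR3 (m l : ℝ) : Prop := m = 0 ∧ l = 0

/-- `M³(m, l)` is locally a round sphere `S³`; its sectional curvature is `m`. -/
def IsS3 (m l : ℝ) : Prop := 0 < m ∧ l ^ 2 = 4 * m

/-- `M³(m, l)` is locally `SU(2)` with a left-invariant metric that is not round. -/
def IsSU2 (m l : ℝ) : Prop := 0 < m ∧ l ≠ 0 ∧ l ^ 2 ≠ 4 * m

/-- `M³(m, l)` is the universal cover of `SL(2, ℝ)` with a left-invariant metric. -/
def IsSL2 (m l : ℝ) : Prop := m < 0 ∧ l ≠ 0

/-- `M³(m, l)` is the Heisenberg group `Nil` with a left-invariant metric. -/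
def IsNil (m l : ℝ) : Prop := m = 0 ∧ l ≠ 0

end BCV

/-!
Along the Hopf cylinder of a curve with geodesic curvature `κ` take the orthonormal frame
`(T, N, ξ)`: the horizontal lift of the velocity, that of the normal, and the vertical field. In
dimension two the conformal change `f⁻¹ φ^* h` multiplies traces by `f`, so the tension field is
`w N` with `w = f κ`, and the three components of the bitension field vanish exactly when
`l ξw - 2 κ Tw - κ' w = 0`, `TTw + ξξw = (κ² + l² - 4m) w` and `l Tw = 0`.

If `l ≠ 0`, then `Tw = 0` and `l ξw = κ' w`. Since `[T, ξ] = 0`, applying `T` gives `κ'' w = 0`,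
while applying `ξ` again gives `κ'² = l² (κ² + l² - 4m)`. Hence, where `w ≠ 0`, differentiating the
last identity yields `κ' = 0` and `κ² = 4m - l²`, so that `l² < 4m`.
-/

namespace BCV

open Filter Topology Matrix

section PartialDerivatives

variable {n : ℕ} {u v : (Fin n → ℝ) → ℝ} {p : Fin n → ℝ}

lemma pd_congr (i : Fin n) (h : u =ᶠ[𝓝 p] v) : pd i u p = pd i v p := by
  rw [pd, pd, h.fderiv_eq]

lemma pd_const (i : Fin n) (a : ℝ) : pd i (fun _ => a) p = 0 := by
  simp [pd]

lemma pd_add (i : Fin n) (hu : DifferentiableAt ℝ u p) (hv : DifferentiableAt ℝ v p) :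
    pd i (fun q => u q + v q) p = pd i u p + pd i v p := by
  simp [pd, fderiv_fun_add hu hv]

lemma pd_sub (i : Fin n) (hu : DifferentiableAt ℝ u p) (hv : DifferentiableAt ℝ v p) :
    pd i (fun q => u q - v q) p = pd i u p - pd i v p := by
  simp [pd, fderiv_fun_sub hu hv]

lemma pd_mul (i : Fin n) (hu : DifferentiableAt ℝ u p) (hv : DifferentiableAt ℝ v p) :
    pd i (fun q => u q * v q) p = pd i u p * v p + u p * pd i v p := by
  simp [pd, fderiv_fun_mul hu hv]
  ring

lemma pd_inv (i : Fin n) (hu : DifferentiableAt ℝ u p) (h : u p ≠ 0) :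
    pd i (fun q => (u q)⁻¹) p = -pd i u p / u p ^ 2 := by
  have hderiv : HasFDerivAt (fun q => (u q)⁻¹) _ p :=
    (hasDerivAt_inv h).comp_hasFDerivAt p hu.hasFDerivAt
  simp [pd, hderiv.fderiv]
  ring

lemma pd_neg (i : Fin n) : pd i (fun q => -u q) p = -pd i u p := by
  simp [pd, fderiv_fun_neg]

lemma pd_const_mul (i : Fin n) (a : ℝ) : pd i (fun q => a * u q) p = a * pd i u p := by
  change fderiv ℝ (a • u) p _ = _
  rw [fderiv_const_smul_field]
  rfl

lemma pd_sum {ι : Type*} [Fintype ι] (i : Fin n) {u : ι → (Fin n → ℝ) → ℝ}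
    (hu : ∀ b, DifferentiableAt ℝ (u b) p) :
    pd i (fun q => ∑ b, u b q) p = ∑ b, pd i (u b) p := by
  simp [pd, fderiv_fun_sum fun b _ => hu b]

lemma pd_comp_coord (i j : Fin n) {g : ℝ → ℝ} {g' : ℝ} (hg : HasDerivAt g g' (p j)) :
    pd i (fun q => g (q j)) p = if i = j then g' else 0 := by
  have h : HasFDerivAt (fun q : Fin n → ℝ => g (q j)) _ p :=
    hg.comp_hasFDerivAt p (hasFDerivAt_apply (𝕜 := ℝ) j p)
  simp [pd, h.fderiv, Pi.single_apply, eq_comm]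

lemma pd_coord (i j : Fin n) : pd i (fun q => q j) p = if i = j then 1 else 0 :=
  pd_comp_coord i j (hasDerivAt_id _)

lemma pd_comp {k : ℕ} (i : Fin k) {φ : (Fin k → ℝ) → Fin n → ℝ} {p : Fin k → ℝ}
    (hu : DifferentiableAt ℝ u (φ p)) (hφ : DifferentiableAt ℝ φ p) :
    pd i (fun q => u (φ q)) p = ∑ b, pd i (fun q => φ q b) p * pd b u (φ p) := by
  have hchain : pd i (fun q => u (φ q)) p = fderiv ℝ u (φ p) (fderiv ℝ φ p (Pi.single i 1)) := by
    rw [pd, fderiv_fun_comp p hu hφ, ContinuousLinearMap.comp_apply]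
  have hcoord (b : Fin n) : pd i (fun q => φ q b) p = fderiv ℝ φ p (Pi.single i 1) b := by
    rw [pd, (hasFDerivAt_pi'.1 hφ.hasFDerivAt b).fderiv]
    rfl
  have hsingle (b : Fin n) : (Pi.single b 1 : Fin n → ℝ) = fun j => if b = j then 1 else 0 := by
    ext j
    simp [Pi.single_apply, eq_comm]
  rw [hchain]
  refine ((fderiv ℝ u (φ p)).toLinearMap.pi_apply_eq_sum_univ _).trans
    (Finset.sum_congr rfl fun b _ => ?_)
  rw [hcoord, pd, hsingle b]
  rfl

lemma contDiffAt_comp_coord {j : Fin n} {g : ℝ → ℝ} (hg : ContDiffAt ℝ ∞ g (p j)) :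
    ContDiffAt ℝ ∞ (fun q => g (q j)) p :=
  ContDiffAt.comp (g := g) p hg (contDiffAt_apply ℝ ℝ j p)

lemma contDiffAt_pd (i : Fin n) (hu : ContDiffAt ℝ ∞ u p) : ContDiffAt ℝ ∞ (pd i u) p :=
  (hu.fderiv_right (m := ∞) le_rfl).clm_apply contDiffAt_const

lemma pd_comm (i j : Fin n) (hu : ContDiffAt ℝ ∞ u p) : pd i (pd j u) p = pd j (pd i u) p := by
  have hdiff : DifferentiableAt ℝ (fderiv ℝ u) p :=
    (hu.fderiv_right (m := ∞) le_rfl).differentiableAt (by simp)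
  have hsecond (i j : Fin n) :
      pd i (pd j u) p = fderiv ℝ (fderiv ℝ u) p (Pi.single i 1) (Pi.single j 1) := by
    change fderiv ℝ (fun q => fderiv ℝ u q (Pi.single j 1)) p (Pi.single i 1) = _
    rw [fderiv_clm_apply hdiff (differentiableAt_const _)]
    simp
  have hsymm : IsSymmSndFDerivAt ℝ u p := hu.isSymmSndFDerivAt <| by
    simpa using WithTop.coe_le_coe.2 (le_top : (2 : ℕ∞) ≤ ⊤)
  rw [hsecond, hsecond, hsymm.eq]

end PartialDerivatives

section MatrixCalculus

variable {n : ℕ} {ι κ μ : Type*} {p : Fin n → ℝ}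

/-- The partial derivative `∂ᵢ W` of a vector-valued function, taken componentwise. -/
noncomputable def pdVec (i : Fin n) (W : (Fin n → ℝ) → ι → ℝ) (p : Fin n → ℝ) : ι → ℝ :=
  fun a => pd i (fun q => W q a) p

/-- The partial derivative `∂ᵢ A` of a matrix-valued function, taken entrywise. -/
noncomputable def pdMatrix (i : Fin n) (A : (Fin n → ℝ) → Matrix ι κ ℝ) (p : Fin n → ℝ) :
    Matrix ι κ ℝ :=
  of fun a b => pd i (fun q => A q a b) p

lemma pdMatrix_congr (i : Fin n) {A B : (Fin n → ℝ) → Matrix ι κ ℝ} (h : A =ᶠ[𝓝 p] B) :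
    pdMatrix i A p = pdMatrix i B p := by
  ext a b
  exact pd_congr i (h.mono fun q hq => by simp only [hq])

lemma pdVec_congr (i : Fin n) {V W : (Fin n → ℝ) → ι → ℝ} (h : V =ᶠ[𝓝 p] W) :
    pdVec i V p = pdVec i W p := by
  ext a
  exact pd_congr i (h.mono fun q hq => by simp only [hq])

lemma pdVec_const (i : Fin n) (v : ι → ℝ) : pdVec i (fun _ => v) p = 0 := by
  ext a
  exact pd_const i _

lemma pdMatrix_const (i : Fin n) (A : Matrix ι κ ℝ) : pdMatrix i (fun _ => A) p = 0 := by
  ext a b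
  exact pd_const i _

lemma pdMatrix_add (i : Fin n) {A B : (Fin n → ℝ) → Matrix ι κ ℝ}
    (hA : ∀ a b, DifferentiableAt ℝ (fun q => A q a b) p)
    (hB : ∀ a b, DifferentiableAt ℝ (fun q => B q a b) p) :
    pdMatrix i (fun q => A q + B q) p = pdMatrix i A p + pdMatrix i B p := by
  ext a b
  exact pd_add i (hA a b) (hB a b)

lemma pdMatrix_mul [Fintype κ] (i : Fin n) {A : (Fin n → ℝ) → Matrix ι κ ℝ}
    {B : (Fin n → ℝ) → Matrix κ μ ℝ} (hA : ∀ a b, DifferentiableAt ℝ (fun q => A q a b) p)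
    (hB : ∀ a b, DifferentiableAt ℝ (fun q => B q a b) p) :
    pdMatrix i (fun q => A q * B q) p = pdMatrix i A p * B p + A p * pdMatrix i B p := by
  ext a b
  simp only [pdMatrix, of_apply, Matrix.add_apply, mul_apply]
  rw [← Finset.sum_add_distrib, pd_sum i fun c => (hA a c).fun_mul (hB c b)]
  exact Finset.sum_congr rfl fun c _ => pd_mul i (hA a c) (hB c b)

lemma differentiableAt_mulVec [Fintype κ] {A : (Fin n → ℝ) → Matrix ι κ ℝ}
    {V : (Fin n → ℝ) → κ → ℝ} (hA : ∀ a b, DifferentiableAt ℝ (fun q => A q a b) p)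
    (hV : ∀ b, DifferentiableAt ℝ (fun q => V q b) p) (a : ι) :
    DifferentiableAt ℝ (fun q => (A q *ᵥ V q) a) p :=
  DifferentiableAt.fun_sum fun b _ => (hA a b).fun_mul (hV b)

lemma pdVec_mulVec [Fintype κ] (i : Fin n) {A : (Fin n → ℝ) → Matrix ι κ ℝ}
    {W : (Fin n → ℝ) → κ → ℝ} (hA : ∀ a b, DifferentiableAt ℝ (fun q => A q a b) p)
    (hW : ∀ b, DifferentiableAt ℝ (fun q => W q b) p) :
    pdVec i (fun q => A q *ᵥ W q) p = pdMatrix i A p *ᵥ W p + A p *ᵥ pdVec i W p := by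
  ext a
  simp only [pdVec, pdMatrix, mulVec, dotProduct, of_apply, Pi.add_apply,
    ← Finset.sum_add_distrib]
  rw [pd_sum i fun c => (hA a c).fun_mul (hW c)]
  exact Finset.sum_congr rfl fun c _ => pd_mul i (hA a c) (hW c)

lemma pdMatrix_comp {k : ℕ} (i : Fin k) {φ : (Fin k → ℝ) → Fin n → ℝ} {p : Fin k → ℝ}
    {A : (Fin n → ℝ) → Matrix ι κ ℝ} (hA : ∀ a b, DifferentiableAt ℝ (fun q => A q a b) (φ p))
    (hφ : DifferentiableAt ℝ φ p) :
    pdMatrix i (fun q => A (φ q)) p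
      = ∑ b, pd i (fun q => φ q b) p • pdMatrix b A (φ p) := by
  ext a c
  simp only [pdMatrix, of_apply, Matrix.sum_apply, Matrix.smul_apply, smul_eq_mul]
  exact pd_comp i (hA a c) hφ

lemma contDiffAt_matrix_mul {E : Type*} [NormedAddCommGroup E] [NormedSpace ℝ E] [Fintype κ]
    {m : WithTop ℕ∞} {p : E} {A : E → Matrix ι κ ℝ} {B : E → Matrix κ μ ℝ}
    (hA : ∀ a b, ContDiffAt ℝ m (fun q => A q a b) p)
    (hB : ∀ a b, ContDiffAt ℝ m (fun q => B q a b) p) (a : ι) (b : μ) :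
    ContDiffAt ℝ m (fun q => (A q * B q) a b) p := by
  simp only [mul_apply]
  exact ContDiffAt.sum fun c _ => (hA a c).mul (hB c b)

lemma pdMatrix_comm (i j : Fin n) {A : (Fin n → ℝ) → Matrix ι κ ℝ}
    (hA : ∀ a b, ContDiffAt ℝ ∞ (fun q => A q a b) p) :
    pdMatrix i (pdMatrix j A) p = pdMatrix j (pdMatrix i A) p := by
  ext a b
  exact pd_comm i j (hA a b)

end MatrixCalculus

section Connection

variable {k n : ℕ} {G h : (Fin n → ℝ) → Matrix (Fin n) (Fin n) ℝ}
  {φ : (Fin k → ℝ) → Fin n → ℝ} {V W : (Fin k → ℝ) → Fin n → ℝ} {p : Fin k → ℝ}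

/-- The matrix of `v ↦ ∇_{∂ᵢ} v - ∂ᵢ v` for the Levi-Civita connection of `G`. -/
noncomputable def connectionMatrix (G : (Fin n → ℝ) → Matrix (Fin n) (Fin n) ℝ) (i : Fin n)
    (p : Fin n → ℝ) : Matrix (Fin n) (Fin n) ℝ :=
  of fun a b => christoffel G a i b p

/-- The matrix of the curvature operator `R(∂_c, ∂_d)` of `G`. -/
noncomputable def curvatureMatrix (G : (Fin n → ℝ) → Matrix (Fin n) (Fin n) ℝ) (c d : Fin n)
    (p : Fin n → ℝ) : Matrix (Fin n) (Fin n) ℝ :=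
  of fun a b => curvature G a b c d p

lemma curvatureMatrix_eq (c d : Fin n) (p : Fin n → ℝ) :
    curvatureMatrix G c d p
      = pdMatrix c (connectionMatrix G d) p - pdMatrix d (connectionMatrix G c) p
        + (connectionMatrix G c p * connectionMatrix G d p
          - connectionMatrix G d p * connectionMatrix G c p) := by
  ext a b
  simp only [curvatureMatrix, curvature, connectionMatrix, pdMatrix, Matrix.add_apply,
    Matrix.sub_apply, mul_apply, of_apply, Finset.sum_sub_distrib]

/-- The matrix of `W ↦ ∇^φ_{∂ᵢ} W - ∂ᵢ W` for the pull-back by `φ` of the Levi-Civita connection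
of `h`. -/
noncomputable def pullbackConnection (h : (Fin n → ℝ) → Matrix (Fin n) (Fin n) ℝ)
    (φ : (Fin k → ℝ) → Fin n → ℝ) (i : Fin k) (p : Fin k → ℝ) : Matrix (Fin n) (Fin n) ℝ :=
  ∑ b, pd i (fun q => φ q b) p • connectionMatrix h b (φ p)

lemma covDeriv_eq (i : Fin k) :
    covDeriv h φ i W p = pdVec i W p + pullbackConnection h φ i p *ᵥ W p := by
  ext a
  simp only [covDeriv, pdVec, pullbackConnection, connectionMatrix, mulVec, dotProduct,
    Pi.add_apply, Matrix.sum_apply, Matrix.smul_apply, of_apply, smul_eq_mul, Finset.sum_mul]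
  rw [Finset.sum_comm]
  exact congrArg _ (Finset.sum_congr rfl fun _ _ => Finset.sum_congr rfl fun _ _ => by ring)

lemma covDeriv_congr (i : Fin k) (hVW : V =ᶠ[𝓝 p] W) :
    covDeriv h φ i V p = covDeriv h φ i W p := by
  rw [covDeriv_eq, covDeriv_eq, pdVec_congr i hVW, hVW.eq_of_nhds]

lemma covDeriv_mulVec {r : ℕ} (i : Fin k) {B : (Fin k → ℝ) → Matrix (Fin n) (Fin r) ℝ}
    {η : Matrix (Fin r) (Fin r) ℝ} {w : (Fin k → ℝ) → Fin r → ℝ}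
    (hB : ∀ a b, DifferentiableAt ℝ (fun q => B q a b) p)
    (hw : ∀ b, DifferentiableAt ℝ (fun q => w q b) p)
    (hη : pdMatrix i B p + pullbackConnection h φ i p * B p = B p * η) :
    covDeriv h φ i (fun q => B q *ᵥ w q) p = B p *ᵥ (pdVec i w p + η *ᵥ w p) := by
  rw [covDeriv_eq, pdVec_mulVec i hB hw, mulVec_add, mulVec_mulVec, mulVec_mulVec, ← hη,
    add_mulVec]
  abel

lemma pdMatrix_mul_add {r m : ℕ} (i : Fin k) {B : (Fin k → ℝ) → Matrix (Fin n) (Fin r) ℝ}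
    {C : (Fin k → ℝ) → Matrix (Fin r) (Fin m) ℝ} {A : Matrix (Fin r) (Fin r) ℝ}
    {η : Matrix (Fin m) (Fin m) ℝ} (hB : ∀ a b, DifferentiableAt ℝ (fun q => B q a b) p)
    (hC : ∀ a b, DifferentiableAt ℝ (fun q => C q a b) p)
    (hA : pdMatrix i B p + pullbackConnection h φ i p * B p = B p * A)
    (hη : pdMatrix i C p + A * C p = C p * η) :
    pdMatrix i (fun q => B q * C q) p + pullbackConnection h φ i p * (B p * C p)
      = B p * C p * η := by
  rw [pdMatrix_mul i hB hC, Matrix.mul_assoc, ← hη, Matrix.mul_add, ← Matrix.mul_assoc _ A, ← hA,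
    Matrix.add_mul, Matrix.mul_assoc]
  abel

end Connection

section CartanFrame

variable {k n : ℕ} {G : (Fin n → ℝ) → Matrix (Fin n) (Fin n) ℝ}
  {θ E : (Fin n → ℝ) → Matrix (Fin n) (Fin n) ℝ}
  {ψ : Fin n → (Fin n → ℝ) → Matrix (Fin n) (Fin n) ℝ} {D : Set (Fin n → ℝ)} {p : Fin n → ℝ}

/-- Cartan's description of the Levi-Civita connection of `G` on the open set `D`: the rows of `θ`
are an orthonormal coframe, the columns of `E` are the dual frame, and `ψ i` is the `∂ᵢ`-component
of the connection form, which is skew-symmetric and satisfies the first structure equation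
`dθ + ψ ∧ θ = 0`. -/
structure IsCartanFrame (G θ E : (Fin n → ℝ) → Matrix (Fin n) (Fin n) ℝ)
    (ψ : Fin n → (Fin n → ℝ) → Matrix (Fin n) (Fin n) ℝ) (D : Set (Fin n → ℝ)) : Prop where
  isOpen : IsOpen D
  smooth_coframe : ∀ p ∈ D, ∀ a b, ContDiffAt ℝ ∞ (fun q => θ q a b) p
  smooth_frame : ∀ p ∈ D, ∀ a b, ContDiffAt ℝ ∞ (fun q => E q a b) p
  smooth_connection : ∀ p ∈ D, ∀ i a b, ContDiffAt ℝ ∞ (fun q => ψ i q a b) p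
  metric_eq : ∀ p ∈ D, G p = (θ p)ᵀ * θ p
  coframe_mul_frame : ∀ p ∈ D, θ p * E p = 1
  skew : ∀ p ∈ D, ∀ i, (ψ i p)ᵀ = -ψ i p
  structure_eq : ∀ p ∈ D, ∀ i j a,
    pdMatrix i θ p a j + (ψ i p * θ p) a j = pdMatrix j θ p a i + (ψ j p * θ p) a i

namespace IsCartanFrame

lemma frame_mul_coframe (hC : IsCartanFrame G θ E ψ D) (hp : p ∈ D) : E p * θ p = 1 :=
  mul_eq_one_comm.1 (hC.coframe_mul_frame p hp)

lemma inv_metric (hC : IsCartanFrame G θ E ψ D) (hp : p ∈ D) : (G p)⁻¹ = E p * (E p)ᵀ := by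
  refine inv_eq_right_inv ?_
  calc G p * (E p * (E p)ᵀ) = (θ p)ᵀ * (θ p * E p) * (E p)ᵀ := by
        simp only [hC.metric_eq p hp, Matrix.mul_assoc]
    _ = (E p * θ p)ᵀ := by rw [hC.coframe_mul_frame p hp, Matrix.mul_one, transpose_mul]
    _ = 1 := by rw [hC.frame_mul_coframe hp, transpose_one]

lemma isUnit_det_metric (hC : IsCartanFrame G θ E ψ D) (hp : p ∈ D) : IsUnit (G p).det := by
  rw [hC.metric_eq p hp, det_mul, det_transpose]
  have hθ := isUnit_det_of_right_inverse (hC.coframe_mul_frame p hp)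
  exact hθ.mul hθ

lemma isSymm_metric (hC : IsCartanFrame G θ E ψ D) (hp : p ∈ D) : (G p).IsSymm := by
  rw [hC.metric_eq p hp]
  exact isSymm_transpose_mul_self _

lemma differentiableAt_metric (hC : IsCartanFrame G θ E ψ D) (hp : p ∈ D) (a b : Fin n) :
    DifferentiableAt ℝ (fun q => G q a b) p := by
  have hθ (a b) := (hC.smooth_coframe p hp a b).differentiableAt (by simp)
  have hmetric : (fun q => G q a b) =ᶠ[𝓝 p] fun q => ∑ c, θ q c a * θ q c b := by
    filter_upwards [hC.isOpen.mem_nhds hp] with q hq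
    rw [hC.metric_eq q hq, mul_apply]
    rfl
  exact (DifferentiableAt.fun_sum fun c _ => (hθ c a).fun_mul (hθ c b)).congr_of_eventuallyEq
    hmetric

lemma pdMatrix_metric (hC : IsCartanFrame G θ E ψ D) (hp : p ∈ D) (i : Fin n) :
    pdMatrix i G p = (pdMatrix i θ p + ψ i p * θ p)ᵀ * θ p
      + (θ p)ᵀ * (pdMatrix i θ p + ψ i p * θ p) := by
  have hθ (a b : Fin n) : DifferentiableAt ℝ (fun q => θ q a b) p :=
    (hC.smooth_coframe p hp a b).differentiableAt (by simp)
  have hmetric : G =ᶠ[𝓝 p] fun q => (θ q)ᵀ * θ q :=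
    eventually_of_mem (hC.isOpen.mem_nhds hp) hC.metric_eq
  have htranspose : pdMatrix i (fun q => (θ q)ᵀ) p = (pdMatrix i θ p)ᵀ := rfl
  rw [pdMatrix_congr i hmetric, pdMatrix_mul i (A := fun q => (θ q)ᵀ) (fun a b => hθ b a) hθ,
    htranspose, transpose_add, transpose_mul, hC.skew p hp]
  noncomm_ring

lemma koszul (hC : IsCartanFrame G θ E ψ D) (hp : p ∈ D) (a i j : Fin n) :
    pd i (fun q => G q a j) p + pd j (fun q => G q a i) p - pd a (fun q => G q i j) p
      = 2 * ((θ p)ᵀ * (pdMatrix i θ p + ψ i p * θ p)) a j := by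
  have hmetric (i a j : Fin n) : pd i (fun q => G q a j) p
      = ∑ b, ((pdMatrix i θ p + ψ i p * θ p) b a * θ p b j
        + θ p b a * (pdMatrix i θ p + ψ i p * θ p) b j) := by
    rw [Finset.sum_add_distrib]
    exact congrFun₂ (hC.pdMatrix_metric hp i) a j
  have hsymm (i j b : Fin n) :
      (pdMatrix i θ p + ψ i p * θ p) b j = (pdMatrix j θ p + ψ j p * θ p) b i :=
    hC.structure_eq p hp i j b
  rw [hmetric, hmetric, hmetric, ← Finset.sum_add_distrib, ← Finset.sum_sub_distrib, mul_apply,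
    Finset.mul_sum]
  refine Finset.sum_congr rfl fun b _ => ?_
  rw [hsymm a i, hsymm a j, hsymm j i, transpose_apply]
  ring

lemma connectionMatrix_eq (hC : IsCartanFrame G θ E ψ D) (hp : p ∈ D) (i : Fin n) :
    connectionMatrix G i p = E p * (pdMatrix i θ p + ψ i p * θ p) := by
  have hchristoffel : connectionMatrix G i p
      = (G p)⁻¹ * ((θ p)ᵀ * (pdMatrix i θ p + ψ i p * θ p)) := by
    ext a b
    simp only [connectionMatrix, christoffel, of_apply, hC.koszul hp]
    rw [mul_apply, Finset.mul_sum]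
    exact Finset.sum_congr rfl fun c _ => by ring
  rw [hchristoffel, hC.inv_metric hp, Matrix.mul_assoc, ← Matrix.mul_assoc _ (θ p)ᵀ,
    ← transpose_mul, hC.coframe_mul_frame p hp, transpose_one, Matrix.one_mul]

lemma pdMatrix_frame_add (hC : IsCartanFrame G θ E ψ D) (hp : p ∈ D) (i : Fin n) :
    pdMatrix i E p + connectionMatrix G i p * E p = E p * ψ i p := by
  have hθ (a b : Fin n) : DifferentiableAt ℝ (fun q => θ q a b) p :=
    (hC.smooth_coframe p hp a b).differentiableAt (by simp)
  have hE (a b : Fin n) : DifferentiableAt ℝ (fun q => E q a b) p :=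
    (hC.smooth_frame p hp a b).differentiableAt (by simp)
  have hone : (fun q => E q * θ q) =ᶠ[𝓝 p] fun _ => 1 :=
    eventually_of_mem (hC.isOpen.mem_nhds hp) fun q hq => hC.frame_mul_coframe hq
  have hdual : pdMatrix i E p * θ p + E p * pdMatrix i θ p = 0 := by
    rw [← pdMatrix_mul i hE hθ, pdMatrix_congr i hone, pdMatrix_const]
  have hframe : pdMatrix i E p = -(E p * pdMatrix i θ p * E p) := by
    calc pdMatrix i E p
        = (pdMatrix i E p * θ p + E p * pdMatrix i θ p) * E p - E p * pdMatrix i θ p * E p := by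
          rw [Matrix.add_mul, Matrix.mul_assoc _ (θ p), hC.coframe_mul_frame p hp,
            Matrix.mul_one, add_sub_cancel_right]
      _ = -(E p * pdMatrix i θ p * E p) := by rw [hdual, Matrix.zero_mul, zero_sub]
  rw [hframe, hC.connectionMatrix_eq hp, Matrix.mul_add, Matrix.add_mul, ← Matrix.mul_assoc (E p),
    Matrix.mul_assoc (E p * ψ i p), hC.coframe_mul_frame p hp, Matrix.mul_one,
    neg_add_cancel_left]

lemma pdMatrix_frame_comp_add (hC : IsCartanFrame G θ E ψ D) {φ : (Fin k → ℝ) → Fin n → ℝ}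
    {p : Fin k → ℝ} (hp : φ p ∈ D) (hφ : DifferentiableAt ℝ φ p) (i : Fin k) :
    pdMatrix i (fun q => E (φ q)) p + pullbackConnection G φ i p * E (φ p)
      = E (φ p) * ∑ b, pd i (fun q => φ q b) p • ψ b (φ p) := by
  have hE (a b : Fin n) : DifferentiableAt ℝ (fun q => E q a b) (φ p) :=
    (hC.smooth_frame _ hp a b).differentiableAt (by simp)
  rw [pdMatrix_comp i hE hφ, pullbackConnection, Finset.sum_mul, ← Finset.sum_add_distrib,
    Finset.mul_sum]
  refine Finset.sum_congr rfl fun b _ => ?_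
  rw [Matrix.smul_mul, ← smul_add, hC.pdMatrix_frame_add hp, Matrix.mul_smul]

lemma contDiffAt_connectionMatrix (hC : IsCartanFrame G θ E ψ D) (hp : p ∈ D) (i a b : Fin n) :
    ContDiffAt ℝ ∞ (fun q => connectionMatrix G i q a b) p := by
  have hfactor (c d : Fin n) :
      ContDiffAt ℝ ∞ (fun q => (pdMatrix i θ q + ψ i q * θ q) c d) p :=
    (contDiffAt_pd i (hC.smooth_coframe p hp c d)).add
      (contDiffAt_matrix_mul (hC.smooth_connection p hp i) (hC.smooth_coframe p hp) c d)
  refine (contDiffAt_matrix_mul (hC.smooth_frame p hp) hfactor a b).congr_of_eventuallyEq ?_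
  filter_upwards [hC.isOpen.mem_nhds hp] with q hq
  rw [hC.connectionMatrix_eq hq]

lemma pdMatrix_connectionMatrix_mul (hC : IsCartanFrame G θ E ψ D) (hp : p ∈ D) (c d : Fin n) :
    pdMatrix c (connectionMatrix G d) p * E p
      = pdMatrix c E p * ψ d p + E p * pdMatrix c (ψ d) p - pdMatrix c (pdMatrix d E) p
        - connectionMatrix G d p * pdMatrix c E p := by
  have hdiff {A : (Fin n → ℝ) → Matrix (Fin n) (Fin n) ℝ}
      (hA : ∀ a b, ContDiffAt ℝ ∞ (fun q => A q a b) p) (a b : Fin n) :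
      DifferentiableAt ℝ (fun q => A q a b) p := (hA a b).differentiableAt (by simp)
  have hE := hC.smooth_frame p hp
  have hΓ := hC.contDiffAt_connectionMatrix hp d
  have hframe : (fun q => pdMatrix d E q + connectionMatrix G d q * E q)
      =ᶠ[𝓝 p] fun q => E q * ψ d q :=
    eventually_of_mem (hC.isOpen.mem_nhds hp) fun q hq => hC.pdMatrix_frame_add hq d
  have hderiv := pdMatrix_congr c hframe
  rw [pdMatrix_add c (A := pdMatrix d E) (hdiff fun a b => contDiffAt_pd d (hE a b))
      (hdiff (contDiffAt_matrix_mul hΓ hE)), pdMatrix_mul c (hdiff hΓ) (hdiff hE),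
    pdMatrix_mul c (hdiff hE) (hdiff (hC.smooth_connection p hp d))] at hderiv
  rw [← hderiv]
  abel

lemma curvatureMatrix_mul_frame (hC : IsCartanFrame G θ E ψ D) (hp : p ∈ D) (c d : Fin n) :
    curvatureMatrix G c d p * E p
      = E p * (pdMatrix c (ψ d) p - pdMatrix d (ψ c) p + (ψ c p * ψ d p - ψ d p * ψ c p)) := by
  have hframe (i : Fin n) : pdMatrix i E p = E p * ψ i p - connectionMatrix G i p * E p :=
    eq_sub_of_add_eq (hC.pdMatrix_frame_add hp i)
  rw [curvatureMatrix_eq, Matrix.add_mul, Matrix.sub_mul, hC.pdMatrix_connectionMatrix_mul hp c d,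
    hC.pdMatrix_connectionMatrix_mul hp d c, pdMatrix_comm d c (hC.smooth_frame p hp), hframe c,
    hframe d]
  noncomm_ring

end IsCartanFrame

end CartanFrame

section Divergence

variable {k n : ℕ} {g : (Fin k → ℝ) → Matrix (Fin k) (Fin k) ℝ}
  {h : (Fin n → ℝ) → Matrix (Fin n) (Fin n) ℝ} {φ : (Fin k → ℝ) → Fin n → ℝ}
  {W : (Fin k → ℝ) → Fin n → ℝ} {Z : Fin k → (Fin k → ℝ) → Fin n → ℝ} {p : Fin k → ℝ}

/-- The divergence `Trace_g ∇Z` of a one-form `Z` with values in the vector fields along `φ`, given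
by its components `Z j = Z(∂ⱼ)`. -/
noncomputable def divergence (g : (Fin k → ℝ) → Matrix (Fin k) (Fin k) ℝ)
    (h : (Fin n → ℝ) → Matrix (Fin n) (Fin n) ℝ) (φ : (Fin k → ℝ) → Fin n → ℝ)
    (Z : Fin k → (Fin k → ℝ) → Fin n → ℝ) (p : Fin k → ℝ) : Fin n → ℝ :=
  ∑ i, ∑ j, (g p)⁻¹ i j • (covDeriv h φ i (Z j) p - ∑ l, christoffel g l i j p • Z l p)

lemma tension_eq_divergence :
    tension g h φ p = divergence g h φ (fun j => pdVec j φ) p := by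
  ext a
  simp only [tension, divergence, Finset.sum_apply, Pi.smul_apply, Pi.sub_apply, smul_eq_mul]
  rfl

lemma roughLaplacian_eq_divergence :
    roughLaplacian g h φ W p = divergence g h φ (fun j => covDeriv h φ j W) p := by
  ext a
  simp only [roughLaplacian, divergence, Finset.sum_apply, Pi.smul_apply, Pi.sub_apply, smul_eq_mul]

lemma covDeriv_sum_smul {ι : Type*} [Fintype ι] (i : Fin k) {u : ι → (Fin k → ℝ) → ℝ}
    {Z : ι → (Fin k → ℝ) → Fin n → ℝ} (hu : ∀ l, DifferentiableAt ℝ (u l) p)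
    (hZ : ∀ l b, DifferentiableAt ℝ (fun q => Z l q b) p) :
    covDeriv h φ i (fun q => ∑ l, u l q • Z l q) p
      = ∑ l, (pd i (u l) p • Z l p + u l p • covDeriv h φ i (Z l) p) := by
  have hleibniz : pdVec i (fun q => ∑ l, u l q • Z l q) p
      = ∑ l, (pd i (u l) p • Z l p + u l p • pdVec i (Z l) p) := by
    ext a
    simp only [pdVec, Finset.sum_apply, Pi.add_apply, Pi.smul_apply, smul_eq_mul]
    rw [pd_sum i fun l => (hu l).fun_mul (hZ l a)]
    exact Finset.sum_congr rfl fun l _ => pd_mul i (hu l) (hZ l a)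
  simp only [covDeriv_eq, hleibniz, mulVec_sum, mulVec_smul, smul_add, Finset.sum_add_distrib,
    add_assoc]

lemma IsCartanFrame.divergence_eq {θ E : (Fin k → ℝ) → Matrix (Fin k) (Fin k) ℝ}
    {ψ : Fin k → (Fin k → ℝ) → Matrix (Fin k) (Fin k) ℝ} {D : Set (Fin k → ℝ)}
    (hC : IsCartanFrame g θ E ψ D) (hp : p ∈ D)
    (hZ : ∀ l b, DifferentiableAt ℝ (fun q => Z l q b) p) :
    divergence g h φ Z p = ∑ i, ∑ j, E p i j •
      (covDeriv h φ i (fun q => ∑ l, E q l j • Z l q) p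
        - ∑ l, (E p * ψ i p) l j • Z l p) := by
  have hderiv (i j : Fin k) : covDeriv h φ i (fun q => ∑ l, E q l j • Z l q) p
        - ∑ l, (E p * ψ i p) l j • Z l p
      = ∑ a, E p a j • (covDeriv h φ i (Z a) p - ∑ l, christoffel g l i a p • Z l p) := by
    rw [covDeriv_sum_smul i (fun l => (hC.smooth_frame p hp l j).differentiableAt (by simp)) hZ,
      ← hC.pdMatrix_frame_add hp i]
    have hcoeff (l : Fin k) : (pdMatrix i E p + connectionMatrix g i p * E p) l j
        = pd i (fun q => E q l j) p + ∑ a, christoffel g l i a p * E p a j := rfl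
    simp only [hcoeff, add_smul, Finset.sum_smul, Finset.sum_add_distrib, smul_sub,
      Finset.smul_sum, smul_smul, Finset.sum_sub_distrib]
    rw [add_sub_add_left_eq_sub, Finset.sum_comm]
    simp only [mul_comm]
  have hinv (i j : Fin k) : (g p)⁻¹ i j = ∑ a, E p i a * E p j a := by
    rw [hC.inv_metric hp]
    rfl
  simp only [divergence, hderiv, hinv, Finset.sum_smul, Finset.smul_sum, smul_smul]
  exact Finset.sum_congr rfl fun i _ => Finset.sum_comm

end Divergence

section ConformalChange

variable {n : ℕ} {G : (Fin n → ℝ) → Matrix (Fin n) (Fin n) ℝ} {u : (Fin n → ℝ) → ℝ}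
  {p : Fin n → ℝ}

lemma matrix_inv_smul {ι K : Type*} [Fintype ι] [DecidableEq ι] [Field K] {c : K}
    {A : Matrix ι ι K} (hc : c ≠ 0) (hA : IsUnit A.det) : (c • A)⁻¹ = c⁻¹ • A⁻¹ :=
  inv_smul' A (Units.mk0 c hc) hA

lemma christoffel_smul (hu : DifferentiableAt ℝ u p) (hu0 : u p ≠ 0)
    (hG : ∀ a b, DifferentiableAt ℝ (fun q => G q a b) p) (hdet : IsUnit (G p).det)
    (l i j : Fin n) :
    christoffel (fun q => u q • G q) l i j p = christoffel G l i j p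
      + (1 / (2 * u p)) * ((1 : Matrix (Fin n) (Fin n) ℝ) l j * pd i u p
        + (1 : Matrix (Fin n) (Fin n) ℝ) l i * pd j u p
        - ((G p)⁻¹ *ᵥ fun a => pd a u p) l * G p i j) := by
  have hpd (i a j : Fin n) : pd i (fun q => u q * G q a j) p
      = pd i u p * G p a j + u p * pd i (fun q => G q a j) p := pd_mul i hu (hG a j)
  rw [← nonsing_inv_mul (G p) hdet]
  simp only [christoffel, Matrix.smul_apply, smul_eq_mul, hpd, matrix_inv_smul hu0 hdet,
    mul_apply, mulVec, dotProduct, Finset.sum_mul, Finset.mul_sum,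
    ← Finset.sum_add_distrib, ← Finset.sum_sub_distrib]
  refine Finset.sum_congr rfl fun a _ => ?_
  field_simp
  ring

lemma sum_inv_mul_christoffel_smul (hu : DifferentiableAt ℝ u p) (hu0 : u p ≠ 0)
    (hG : ∀ a b, DifferentiableAt ℝ (fun q => G q a b) p) (hdet : IsUnit (G p).det)
    (hsymm : (G p).IsSymm) (l : Fin n) :
    ∑ i, ∑ j, (G p)⁻¹ i j * christoffel (fun q => u q • G q) l i j p
      = ∑ i, ∑ j, (G p)⁻¹ i j * christoffel G l i j p
        + (2 - n) / (2 * u p) * ((G p)⁻¹ *ᵥ fun a => pd a u p) l := by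
  have hinv_symm (i j : Fin n) : (G p)⁻¹ i j = (G p)⁻¹ j i := by
    rw [← transpose_apply (G p)⁻¹, transpose_nonsing_inv, hsymm.eq]
  have htrace : ∑ i, ∑ j, (G p)⁻¹ i j * G p i j = n := by
    have h := congrArg trace (nonsing_inv_mul (G p) hdet)
    simpa [trace, mul_apply, hsymm.apply] using h
  have hright : ∑ i, ∑ j, (G p)⁻¹ i j * ((1 : Matrix (Fin n) (Fin n) ℝ) l j * pd i u p)
      = ((G p)⁻¹ *ᵥ fun a => pd a u p) l := by
    simp [one_apply, mulVec, dotProduct, hinv_symm l]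
  have hleft : ∑ i, ∑ j, (G p)⁻¹ i j * ((1 : Matrix (Fin n) (Fin n) ℝ) l i * pd j u p)
      = ((G p)⁻¹ *ᵥ fun a => pd a u p) l := by
    simp [one_apply, mulVec, dotProduct]
  set V := ((G p)⁻¹ *ᵥ fun a => pd a u p) l
  calc ∑ i, ∑ j, (G p)⁻¹ i j * christoffel (fun q => u q • G q) l i j p
      = ∑ i, ∑ j, (G p)⁻¹ i j * christoffel G l i j p + 1 / (2 * u p) *
          (∑ i, ∑ j, (G p)⁻¹ i j * ((1 : Matrix (Fin n) (Fin n) ℝ) l j * pd i u p)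
            + ∑ i, ∑ j, (G p)⁻¹ i j * ((1 : Matrix (Fin n) (Fin n) ℝ) l i * pd j u p)
            - V * ∑ i, ∑ j, (G p)⁻¹ i j * G p i j) := by
        simp only [christoffel_smul hu hu0 hG hdet, Finset.mul_sum, ← Finset.sum_add_distrib,
          ← Finset.sum_sub_distrib]
        exact Finset.sum_congr rfl fun i _ => Finset.sum_congr rfl fun j _ => by ring
    _ = _ := by
        rw [hright, hleft, htrace]
        ring

lemma divergence_smul_of_surface {n : ℕ} {g : (Fin 2 → ℝ) → Matrix (Fin 2) (Fin 2) ℝ}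
    {u : (Fin 2 → ℝ) → ℝ} {p : Fin 2 → ℝ} {h : (Fin n → ℝ) → Matrix (Fin n) (Fin n) ℝ}
    {φ : (Fin 2 → ℝ) → Fin n → ℝ} {Z : Fin 2 → (Fin 2 → ℝ) → Fin n → ℝ}
    (hu : DifferentiableAt ℝ u p) (hu0 : u p ≠ 0)
    (hg : ∀ a b, DifferentiableAt ℝ (fun q => g q a b) p) (hdet : IsUnit (g p).det)
    (hsymm : (g p).IsSymm) :
    divergence (fun q => u q • g q) h φ Z p = (u p)⁻¹ • divergence g h φ Z p := by
  have hexpand (g' : (Fin 2 → ℝ) → Matrix (Fin 2) (Fin 2) ℝ) :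
      ∑ i, ∑ j, (g p)⁻¹ i j • (covDeriv h φ i (Z j) p - ∑ l, christoffel g' l i j p • Z l p)
        = ∑ i, ∑ j, (g p)⁻¹ i j • covDeriv h φ i (Z j) p
          - ∑ l, (∑ i, ∑ j, (g p)⁻¹ i j * christoffel g' l i j p) • Z l p := by
    simp only [smul_sub, Finset.sum_sub_distrib, Finset.smul_sum, Finset.sum_smul, smul_smul]
    refine congrArg _ (Eq.symm ?_)
    rw [Finset.sum_comm]
    exact Finset.sum_congr rfl fun i _ => Finset.sum_comm
  simp only [divergence, matrix_inv_smul hu0 hdet, Matrix.smul_apply, smul_assoc,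
    ← Finset.smul_sum]
  rw [hexpand, hexpand]
  simp only [sum_inv_mul_christoffel_smul hu hu0 hg hdet hsymm, Nat.cast_ofNat, sub_self, zero_div,
    zero_mul, add_zero]

end ConformalChange

section CurvatureOperator

variable {k n : ℕ} {g : (Fin k → ℝ) → Matrix (Fin k) (Fin k) ℝ}
  {h : (Fin n → ℝ) → Matrix (Fin n) (Fin n) ℝ}

/-- The matrix of the curvature operator `R(X, Y)` of `h` at the point `x`. -/
noncomputable def curvatureOperator (h : (Fin n → ℝ) → Matrix (Fin n) (Fin n) ℝ)
    (x X Y : Fin n → ℝ) : Matrix (Fin n) (Fin n) ℝ :=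
  ∑ c, ∑ d, (X c * Y d) • curvatureMatrix h c d x

lemma curvatureOperator_sum_smul {ι : Type*} [Fintype ι] (x Y : Fin n → ℝ) (u : ι → ℝ)
    (X : ι → Fin n → ℝ) :
    curvatureOperator h x (∑ i, u i • X i) Y = ∑ i, u i • curvatureOperator h x (X i) Y := by
  simp only [curvatureOperator, Finset.sum_apply, Pi.smul_apply, smul_eq_mul, Finset.sum_mul,
    Finset.sum_smul, Finset.smul_sum, smul_smul, mul_assoc]
  rw [eq_comm, Finset.sum_comm]
  exact Finset.sum_congr rfl fun c _ => Finset.sum_comm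

lemma curvatureTrace_eq {φ W : (Fin k → ℝ) → Fin n → ℝ} {p : Fin k → ℝ} :
    curvatureTrace g h φ W p = ∑ i, ∑ j, (g p)⁻¹ i j •
      (curvatureOperator h (φ p) (pdVec i φ p) (W p) *ᵥ pdVec j φ p) := by
  ext a
  simp only [curvatureTrace, curvatureOperator, curvatureMatrix, pdVec, mulVec, dotProduct,
    Finset.sum_apply, Pi.smul_apply, Matrix.sum_apply, Matrix.smul_apply, of_apply, smul_eq_mul,
    Finset.sum_mul]
  refine Finset.sum_congr rfl fun i _ => Finset.sum_congr rfl fun j _ => congrArg _ ?_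
  exact Finset.sum_congr rfl fun b _ => Finset.sum_congr rfl fun c _ =>
    Finset.sum_congr rfl fun d _ => by ring

lemma curvatureTrace_eq_of_inv {φ W : (Fin k → ℝ) → Fin n → ℝ} {p : Fin k → ℝ} {u : ℝ}
    {A : Matrix (Fin k) (Fin k) ℝ} (hA : (g p)⁻¹ = u • (A * Aᵀ)) :
    curvatureTrace g h φ W p = u • ∑ l, curvatureOperator h (φ p) (∑ i, A i l • pdVec i φ p) (W p)
      *ᵥ ∑ j, A j l • pdVec j φ p := by
  simp only [curvatureTrace_eq, hA, curvatureOperator_sum_smul, sum_mulVec, mulVec_sum, smul_mulVec,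
    mulVec_smul, Matrix.smul_apply, mul_apply, transpose_apply, smul_eq_mul, Finset.mul_sum,
    Finset.sum_smul, Finset.smul_sum, smul_smul]
  rw [Finset.sum_comm, eq_comm, Finset.sum_comm]
  refine Finset.sum_congr rfl fun j _ => ?_
  rw [Finset.sum_comm]
  exact Finset.sum_congr rfl fun i _ => Finset.sum_congr rfl fun l _ => by rw [mul_comm (A j l)]

end CurvatureOperator

section CrossProduct

/-- The matrix of `x ↦ v ⨯₃ x`; these are the skew-symmetric `3 × 3` matrices. -/
noncomputable def crossMatrix : (Fin 3 → ℝ) →ₗ[ℝ] Matrix (Fin 3) (Fin 3) ℝ :=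
  LinearMap.toMatrix'.toLinearMap ∘ₗ crossProduct

lemma crossMatrix_mulVec (v x : Fin 3 → ℝ) : crossMatrix v *ᵥ x = v ⨯₃ x :=
  LinearMap.toMatrix'_mulVec _ _

lemma crossMatrix_apply (v : Fin 3 → ℝ) :
    crossMatrix v = !![0, -v 2, v 1; v 2, 0, -v 0; -v 1, v 0, 0] := by
  refine ext_of_mulVec_single fun b => ?_
  rw [crossMatrix_mulVec, cross_apply]
  ext a
  fin_cases a <;> simp [mulVec, dotProduct, Fin.sum_univ_three] <;> ring

lemma transpose_crossMatrix (v : Fin 3 → ℝ) : (crossMatrix v)ᵀ = -crossMatrix v := by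
  rw [crossMatrix_apply]
  ext a b
  fin_cases a <;> fin_cases b <;> simp

lemma crossMatrix_cross (v w : Fin 3 → ℝ) :
    crossMatrix (v ⨯₃ w) = crossMatrix v * crossMatrix w - crossMatrix w * crossMatrix v := by
  refine ext_of_mulVec_single fun b => ?_
  simp only [sub_mulVec, ← mulVec_mulVec, crossMatrix_mulVec, cross_cross]

lemma pdMatrix_crossMatrix {n : ℕ} (i : Fin n) {v : (Fin n → ℝ) → Fin 3 → ℝ} {p : Fin n → ℝ} :
    pdMatrix i (fun q => crossMatrix (v q)) p = crossMatrix (pdVec i v p) := by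
  ext a b
  simp only [pdMatrix, pdVec, crossMatrix_apply]
  fin_cases a <;> fin_cases b <;> simp [pd_neg, pd_const]

lemma sum_smul_mul_cross_col {n : ℕ} (K : Fin 3 → ℝ) (A : Matrix (Fin 3) (Fin n) ℝ)
    (X Y : Fin n → ℝ) :
    ∑ c, ∑ d, (X c * Y d) • (K * (A.col c ⨯₃ A.col d)) = K * ((A *ᵥ X) ⨯₃ (A *ᵥ Y)) := by
  have hmulVec (Z : Fin n → ℝ) : A *ᵥ Z = ∑ c, Z c • A.col c := by
    ext a
    simp [mulVec, dotProduct, mul_comm]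
  simp only [hmulVec, map_sum, map_smul, LinearMap.sum_apply, LinearMap.smul_apply,
    Finset.mul_sum, mul_smul_comm, Finset.smul_sum, smul_smul]
  rw [Finset.sum_comm]
  simp only [mul_comm (X _)]

/-- The rotation about the third coordinate axis by the angle with cosine `u` and sine `v`; this is
a rotation only if `u ^ 2 + v ^ 2 = 1`. -/
def verticalRotation (u v : ℝ) : Matrix (Fin 3) (Fin 3) ℝ :=
  !![u, -v, 0; v, u, 0; 0, 0, 1]

lemma transpose_verticalRotation_mul_self {u v : ℝ} (h : u ^ 2 + v ^ 2 = 1) :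
    (verticalRotation u v)ᵀ * verticalRotation u v = 1 := by
  ext a b
  fin_cases a <;> fin_cases b <;>
    simp [verticalRotation, mul_apply, Fin.sum_univ_three, mul_comm] <;> linear_combination h

lemma verticalRotation_mulVec_cross {u v : ℝ} (h : u ^ 2 + v ^ 2 = 1) (x y : Fin 3 → ℝ) :
    (verticalRotation u v *ᵥ x) ⨯₃ (verticalRotation u v *ᵥ y)
      = verticalRotation u v *ᵥ (x ⨯₃ y) := by
  ext a
  fin_cases a <;> simp [verticalRotation, cross_apply, mulVec, dotProduct, Fin.sum_univ_three]
  · ring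
  · ring
  · linear_combination (x 0 * y 1 - x 1 * y 0) * h

lemma crossMatrix_mul_verticalRotation {u v : ℝ} (h : u ^ 2 + v ^ 2 = 1) (x : Fin 3 → ℝ) :
    crossMatrix (verticalRotation u v *ᵥ x) * verticalRotation u v
      = verticalRotation u v * crossMatrix x := by
  refine ext_of_mulVec_single fun b => ?_
  simp only [← mulVec_mulVec, crossMatrix_mulVec, verticalRotation_mulVec_cross h]

end CrossProduct

section BCVSpace

variable {m l : ℝ} {p : Fin 3 → ℝ}

/-- The orthonormal frame of the BCV space `M³(m, l)` dual to `bcvCoframe`, as matrix columns. -/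
noncomputable def bcvFrame (m l : ℝ) (p : Fin 3 → ℝ) : Matrix (Fin 3) (Fin 3) ℝ :=
  !![factor m (p 0) (p 1), 0, 0;
     0, factor m (p 0) (p 1), 0;
     -((l / 2) * p 1), (l / 2) * p 0, 1]

/-- The connection form of `bcvFrame`: the value of the form on `∂ᵢ` is the skew-symmetric
endomorphism `x ↦ bcvConnection m l i p ⨯₃ x` of frame coordinates. -/
noncomputable def bcvConnection (m l : ℝ) (i : Fin 3) (p : Fin 3 → ℝ) : Fin 3 → ℝ :=
  ![![(l / 2) * (1 / factor m (p 0) (p 1)), 0,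
        (2 * m - l ^ 2 / 4) * (p 1 / factor m (p 0) (p 1))],
    ![0, (l / 2) * (1 / factor m (p 0) (p 1)),
        -((2 * m - l ^ 2 / 4) * (p 0 / factor m (p 0) (p 1)))],
    ![0, 0, -(l / 2)]] i

lemma contDiff_factor : ContDiff ℝ ∞ fun q : Fin 3 → ℝ => factor m (q 0) (q 1) := by
  unfold factor
  fun_prop

lemma pd_factor (i : Fin 3) :
    pd i (fun q : Fin 3 → ℝ => factor m (q 0) (q 1)) p = ![2 * m * p 0, 2 * m * p 1, 0] i := by
  have hsq (j : Fin 3) : pd i (fun q : Fin 3 → ℝ => q j ^ 2) p = if i = j then 2 * p j else 0 :=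
    pd_comp_coord i j (g := fun t => t ^ 2) (by simpa using hasDerivAt_pow 2 (p j))
  have hdiff (j : Fin 3) : DifferentiableAt ℝ (fun q : Fin 3 → ℝ => q j ^ 2) p := by fun_prop
  unfold factor
  rw [pd_add i (differentiableAt_const _) (((hdiff 0).fun_add (hdiff 1)).const_mul m), pd_const,
    pd_const_mul, pd_add i (hdiff 0) (hdiff 1), hsq, hsq]
  fin_cases i <;> simp <;> ring

lemma pd_one_div_factor (hp : factor m (p 0) (p 1) ≠ 0) (i : Fin 3) :
    pd i (fun q : Fin 3 → ℝ => 1 / factor m (q 0) (q 1)) p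
      = -![2 * m * p 0, 2 * m * p 1, 0] i / factor m (p 0) (p 1) ^ 2 := by
  simp only [one_div]
  rw [pd_inv i (contDiff_factor.differentiable (by simp) p) hp, pd_factor]

lemma pd_coord_div_factor (hp : factor m (p 0) (p 1) ≠ 0) (i j : Fin 3) :
    pd i (fun q : Fin 3 → ℝ => q j / factor m (q 0) (q 1)) p
      = (if i = j then 1 else 0) / factor m (p 0) (p 1)
        - p j * ![2 * m * p 0, 2 * m * p 1, 0] i / factor m (p 0) (p 1) ^ 2 := by
  have hfactor : DifferentiableAt ℝ (fun q : Fin 3 → ℝ => (factor m (q 0) (q 1))⁻¹) p :=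
    (contDiff_factor.differentiable (by simp) p).inv hp
  simp only [div_eq_mul_inv (_ : ℝ) (factor m _ _)]
  rw [pd_mul i (by fun_prop) hfactor, pd_coord,
    pd_inv i (contDiff_factor.differentiable (by simp) p) hp, pd_factor]
  ring

lemma bcvCoframe_mul_bcvFrame (hp : factor m (p 0) (p 1) ≠ 0) :
    bcvCoframe m l p * bcvFrame m l p = 1 := by
  ext a b
  fin_cases a <;> fin_cases b <;>
    simp [bcvCoframe, bcvFrame, mul_apply, Fin.sum_univ_three, hp] <;> field_simp <;> ring

lemma bcv_structure_eq (hp : factor m (p 0) (p 1) ≠ 0) (i j : Fin 3) :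
    pdVec i (fun q => (bcvCoframe m l q).col j) p
        + bcvConnection m l i p ⨯₃ (bcvCoframe m l p).col j
      = pdVec j (fun q => (bcvCoframe m l q).col i) p
        + bcvConnection m l j p ⨯₃ (bcvCoframe m l p).col i := by
  ext a
  fin_cases i <;> fin_cases j <;> fin_cases a <;>
    simp [pdVec, bcvCoframe, bcvConnection, cross_apply, pd_const, pd_const_mul, pd_neg,
      pd_one_div_factor hp, pd_coord_div_factor hp, -one_div, -mul_eq_mul_left_iff] <;>
    unfold factor at * <;> field_simp <;> ring

lemma isCartanFrame_bcvFrame (m l : ℝ) :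
    IsCartanFrame (bcvMetric m l) (bcvCoframe m l) (bcvFrame m l)
      (fun i q => crossMatrix (bcvConnection m l i q)) {q | 0 < factor m (q 0) (q 1)} where
  isOpen := isOpen_lt continuous_const contDiff_factor.continuous
  smooth_coframe p hp a b := by
    have hF := (contDiff_factor (m := m)).contDiffAt (x := p)
    have hF0 : factor m (p 0) (p 1) ≠ 0 := ne_of_gt hp
    fin_cases a <;> fin_cases b <;> simp only [bcvCoframe, of_apply, cons_val', cons_val_fin_one,
      cons_val, Fin.zero_eta, Fin.mk_one, Fin.reduceFinMk] <;> fun_prop (disch := assumption)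
  smooth_frame p _ a b := by
    have hF := (contDiff_factor (m := m)).contDiffAt (x := p)
    fin_cases a <;> fin_cases b <;> simp only [bcvFrame, of_apply, cons_val', cons_val_fin_one,
      cons_val, Fin.zero_eta, Fin.mk_one, Fin.reduceFinMk] <;> fun_prop
  smooth_connection p hp i a b := by
    have hF := (contDiff_factor (m := m)).contDiffAt (x := p)
    have hF0 : factor m (p 0) (p 1) ≠ 0 := ne_of_gt hp
    simp only [crossMatrix_apply]
    fin_cases i <;> fin_cases a <;> fin_cases b <;> simp only [bcvConnection, of_apply,
      cons_val', cons_val_fin_one, cons_val, Fin.zero_eta, Fin.mk_one, Fin.reduceFinMk] <;>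
      fun_prop (disch := assumption)
  metric_eq _ _ := rfl
  coframe_mul_frame _ hp := bcvCoframe_mul_bcvFrame (ne_of_gt hp)
  skew _ _ _ := transpose_crossMatrix _
  structure_eq p hp i j a := by
    have h := congrFun (bcv_structure_eq (l := l) (ne_of_gt hp) i j) a
    simp only [← crossMatrix_mulVec] at h
    exact h

/-- The eigenvalues, in the basis dual to `bcvFrame`, of the curvature operator of the BCV space
on two-forms identified with vectors by the cross product. -/
noncomputable def bcvCurvature (m l : ℝ) : Fin 3 → ℝ :=
  ![l ^ 2 / 4, l ^ 2 / 4, 4 * m - 3 * l ^ 2 / 4]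

lemma bcv_curvature_form (hp : factor m (p 0) (p 1) ≠ 0) (c d : Fin 3) :
    pdVec c (bcvConnection m l d) p - pdVec d (bcvConnection m l c) p
        + bcvConnection m l c p ⨯₃ bcvConnection m l d p
      = -(bcvCurvature m l * ((bcvCoframe m l p).col c ⨯₃ (bcvCoframe m l p).col d)) := by
  ext a
  fin_cases c <;> fin_cases d <;> fin_cases a <;>
    simp [pdVec, bcvCoframe, bcvConnection, bcvCurvature, cross_apply, pd_const, pd_const_mul,
      pd_neg, pd_one_div_factor hp, pd_coord_div_factor hp, -one_div, -mul_eq_mul_left_iff] <;>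
    unfold factor at * <;> field_simp <;> ring

lemma curvatureMatrix_bcvMetric_mul (hp : 0 < factor m (p 0) (p 1)) (c d : Fin 3) :
    curvatureMatrix (bcvMetric m l) c d p * bcvFrame m l p
      = -(bcvFrame m l p * crossMatrix
          (bcvCurvature m l * ((bcvCoframe m l p).col c ⨯₃ (bcvCoframe m l p).col d))) := by
  rw [(isCartanFrame_bcvFrame m l).curvatureMatrix_mul_frame hp, pdMatrix_crossMatrix,
    pdMatrix_crossMatrix, ← crossMatrix_cross, ← map_sub, ← map_add,
    bcv_curvature_form hp.ne', map_neg, Matrix.mul_neg]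

lemma curvatureOperator_bcvMetric (hp : 0 < factor m (p 0) (p 1)) (x y z : Fin 3 → ℝ) :
    curvatureOperator (bcvMetric m l) p (bcvFrame m l p *ᵥ x) (bcvFrame m l p *ᵥ y)
        *ᵥ (bcvFrame m l p *ᵥ z)
      = -(bcvFrame m l p *ᵥ ((bcvCurvature m l * (x ⨯₃ y)) ⨯₃ z)) := by
  have hcoframe (x : Fin 3 → ℝ) : bcvCoframe m l p *ᵥ bcvFrame m l p *ᵥ x = x := by
    rw [mulVec_mulVec, bcvCoframe_mul_bcvFrame hp.ne', one_mulVec]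
  have hoperator (X Y : Fin 3 → ℝ) :
      curvatureOperator (bcvMetric m l) p X Y * bcvFrame m l p
        = -(bcvFrame m l p * crossMatrix
          (bcvCurvature m l * ((bcvCoframe m l p *ᵥ X) ⨯₃ (bcvCoframe m l p *ᵥ Y)))) := by
    simp only [curvatureOperator, Finset.sum_mul, Matrix.smul_mul, curvatureMatrix_bcvMetric_mul hp,
      ← sum_smul_mul_cross_col, map_sum, map_smul, Matrix.mul_sum, Matrix.mul_smul, smul_neg,
      Finset.sum_neg_distrib]
  rw [mulVec_mulVec, hoperator, hcoframe, hcoframe, neg_mulVec, ← mulVec_mulVec,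
    crossMatrix_mulVec]

end BCVSpace

section BaseCurve

variable {m l : ℝ} {I : Set ℝ} {x y : ℝ → ℝ} {s : ℝ}

/-- The first component of the velocity of the base curve `(x, y)` in the orthonormal frame
`F ∂ₓ, F ∂_y`. -/
noncomputable def tangentX (m : ℝ) (x y : ℝ → ℝ) (s : ℝ) : ℝ := deriv x s / factor m (x s) (y s)

/-- The second component of the velocity of the base curve `(x, y)` in the orthonormal frame
`F ∂ₓ, F ∂_y`. -/
noncomputable def tangentY (m : ℝ) (x y : ℝ → ℝ) (s : ℝ) : ℝ := deriv y s / factor m (x s) (y s)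

/-- The geodesic curvature of the base curve `(x, y)` in the metric `(dx² + dy²) / F²`. -/
noncomputable def geodesicCurvature (m : ℝ) (x y : ℝ → ℝ) (s : ℝ) : ℝ :=
  tangentX m x y s * deriv (tangentY m x y) s - tangentY m x y s * deriv (tangentX m x y) s
    + 2 * m * (y s * tangentX m x y s - x s * tangentY m x y s)

/-- The vertical component of the coordinate field `∂ₛ` of the Hopf cylinder over `(x, y)`, which
therefore is `T + verticalComponent • ξ` with `T` the horizontal lift of the velocity and `ξ` the
unit vertical field. -/
noncomputable def verticalComponent (m l : ℝ) (x y : ℝ → ℝ) (s : ℝ) : ℝ :=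
  (l / 2) * (y s * tangentX m x y s - x s * tangentY m x y s)

namespace IsBaseCurve

lemma contDiffAt (hγ : IsBaseCurve m I x y) (hs : s ∈ I) :
    ContDiffAt ℝ ∞ x s ∧ ContDiffAt ℝ ∞ y s :=
  ⟨hγ.smooth_x.contDiffAt (hγ.isOpen.mem_nhds hs), hγ.smooth_y.contDiffAt (hγ.isOpen.mem_nhds hs)⟩

lemma contDiffAt_tangent (hγ : IsBaseCurve m I x y) (hs : s ∈ I) :
    ContDiffAt ℝ ∞ (tangentX m x y) s ∧ ContDiffAt ℝ ∞ (tangentY m x y) s := by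
  obtain ⟨hx, hy⟩ := hγ.contDiffAt hs
  have hfactor : ContDiffAt ℝ ∞ (fun s => factor m (x s) (y s)) s := by
    unfold factor
    fun_prop
  have hfactor0 := (hγ.mem_base s hs).ne'
  exact ⟨(hx.derivWithin le_rfl).div hfactor hfactor0, (hy.derivWithin le_rfl).div hfactor hfactor0⟩

lemma contDiffAt_geodesicCurvature (hγ : IsBaseCurve m I x y) (hs : s ∈ I) :
    ContDiffAt ℝ ∞ (geodesicCurvature m x y) s := by
  obtain ⟨hx, hy⟩ := hγ.contDiffAt hs
  obtain ⟨hu, hv⟩ := hγ.contDiffAt_tangent hs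
  have hu' : ContDiffAt ℝ ∞ (deriv (tangentX m x y)) s := hu.derivWithin le_rfl
  have hv' : ContDiffAt ℝ ∞ (deriv (tangentY m x y)) s := hv.derivWithin le_rfl
  unfold geodesicCurvature
  fun_prop

lemma contDiffAt_verticalComponent (hγ : IsBaseCurve m I x y) (hs : s ∈ I) :
    ContDiffAt ℝ ∞ (verticalComponent m l x y) s := by
  obtain ⟨hx, hy⟩ := hγ.contDiffAt hs
  obtain ⟨hu, hv⟩ := hγ.contDiffAt_tangent hs
  unfold verticalComponent
  fun_prop

lemma tangent_sq_add_sq (hγ : IsBaseCurve m I x y) (hs : s ∈ I) :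
    tangentX m x y s ^ 2 + tangentY m x y s ^ 2 = 1 := by
  rw [tangentX, tangentY, div_pow, div_pow, ← add_div, hγ.unit_speed s hs]

lemma deriv_eq_factor_mul_tangent (hγ : IsBaseCurve m I x y) (hs : s ∈ I) :
    deriv x s = factor m (x s) (y s) * tangentX m x y s
      ∧ deriv y s = factor m (x s) (y s) * tangentY m x y s :=
  ⟨(mul_div_cancel₀ _ (hγ.mem_base s hs).ne').symm, (mul_div_cancel₀ _ (hγ.mem_base s hs).ne').symm⟩

lemma deriv_tangent (hγ : IsBaseCurve m I x y) (hs : s ∈ I) :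
    deriv (tangentX m x y) s = -(geodesicCurvature m x y s
        - 2 * m * (y s * tangentX m x y s - x s * tangentY m x y s)) * tangentY m x y s
      ∧ deriv (tangentY m x y) s = (geodesicCurvature m x y s
        - 2 * m * (y s * tangentX m x y s - x s * tangentY m x y s)) * tangentX m x y s := by
  have hunit := hγ.tangent_sq_add_sq hs
  have horthogonal : tangentX m x y s * deriv (tangentX m x y) s
      + tangentY m x y s * deriv (tangentY m x y) s = 0 := by
    obtain ⟨hu, hv⟩ := hγ.contDiffAt_tangent hs
    have hderiv : HasDerivAt (fun t => tangentX m x y t ^ 2 + tangentY m x y t ^ 2) _ s :=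
      ((hu.differentiableAt (by simp)).hasDerivAt.pow 2).add
        ((hv.differentiableAt (by simp)).hasDerivAt.pow 2)
    have hconst : (fun t => tangentX m x y t ^ 2 + tangentY m x y t ^ 2) =ᶠ[𝓝 s] fun _ => 1 :=
      eventually_of_mem (hγ.isOpen.mem_nhds hs) fun t ht => hγ.tangent_sq_add_sq ht
    have hzero := hderiv.unique ((hasDerivAt_const s (1 : ℝ)).congr_of_eventuallyEq hconst)
    linear_combination hzero / 2
  unfold geodesicCurvature
  constructor
  · linear_combination tangentX m x y s * horthogonal - deriv (tangentX m x y) s * hunit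
  · linear_combination tangentY m x y s * horthogonal - deriv (tangentY m x y) s * hunit

end IsBaseCurve

end BaseCurve

section HopfCylinder

variable {m l : ℝ} {I : Set ℝ} {x y : ℝ → ℝ} {p : Fin 2 → ℝ}

/-- The orthonormal frame `(T, N, ξ)` along the Hopf cylinder over `(x, y)`, as matrix columns:
`T` and `N` are the horizontal lifts of the velocity and of the normal of the base curve, and `ξ`
is the unit vertical field. -/
noncomputable def hopfFrame (m l : ℝ) (x y : ℝ → ℝ) (p : Fin 2 → ℝ) : Matrix (Fin 3) (Fin 3) ℝ :=
  bcvFrame m l (hopfCylinder x y p)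
    * verticalRotation (tangentX m x y (p 0)) (tangentY m x y (p 0))

namespace IsBaseCurve

lemma contDiffAt_hopfCylinder (hγ : IsBaseCurve m I x y) (hp : p 0 ∈ I) :
    ContDiffAt ℝ ∞ (hopfCylinder x y) p := by
  obtain ⟨hx, hy⟩ := hγ.contDiffAt hp
  refine contDiffAt_pi.2 fun b => ?_
  fin_cases b
  exacts [contDiffAt_comp_coord hx, contDiffAt_comp_coord hy, contDiffAt_apply ℝ ℝ 1 p]

lemma pdVec_hopfCylinder (hγ : IsBaseCurve m I x y) (hp : p 0 ∈ I) (i : Fin 2) :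
    pdVec i (hopfCylinder x y) p = ![![deriv x (p 0), deriv y (p 0), 0], ![0, 0, 1]] i := by
  obtain ⟨hx, hy⟩ := hγ.contDiffAt hp
  ext b
  fin_cases b
  · refine (pd_comp_coord i 0 (hx.differentiableAt (by simp)).hasDerivAt).trans ?_
    fin_cases i <;> rfl
  · refine (pd_comp_coord i 0 (hy.differentiableAt (by simp)).hasDerivAt).trans ?_
    fin_cases i <;> rfl
  · refine (pd_coord i 1).trans ?_
    fin_cases i <;> rfl

lemma pdVec_hopfCylinder_eq_mulVec (hγ : IsBaseCurve m I x y) (hp : p 0 ∈ I) (i : Fin 2) :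
    pdVec i (hopfCylinder x y) p
      = hopfFrame m l x y p *ᵥ ![![1, 0, verticalComponent m l x y (p 0)], ![0, 0, 1]] i := by
  obtain ⟨hx', hy'⟩ := hγ.deriv_eq_factor_mul_tangent hp
  rw [hγ.pdVec_hopfCylinder hp, hopfFrame, ← mulVec_mulVec, hx', hy']
  ext b
  fin_cases i <;> fin_cases b <;>
    simp [bcvFrame, hopfCylinder, verticalRotation, verticalComponent, mulVec, dotProduct,
      Fin.sum_univ_three]
  ring

lemma contDiffAt_rotation (hγ : IsBaseCurve m I x y) (hp : p 0 ∈ I) (a b : Fin 3) :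
    ContDiffAt ℝ ∞ (fun q : Fin 2 → ℝ =>
      verticalRotation (tangentX m x y (q 0)) (tangentY m x y (q 0)) a b) p := by
  obtain ⟨hu, hv⟩ := hγ.contDiffAt_tangent hp
  have hu0 := contDiffAt_comp_coord hu
  have hv0 := contDiffAt_comp_coord hv
  fin_cases a <;> fin_cases b <;> simp [verticalRotation] <;> fun_prop

lemma contDiffAt_bcvFrame_comp (hγ : IsBaseCurve m I x y) (hp : p 0 ∈ I) (a b : Fin 3) :
    ContDiffAt ℝ ∞ (fun q => bcvFrame m l (hopfCylinder x y q) a b) p :=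
  ((isCartanFrame_bcvFrame m l).smooth_frame _ (hγ.mem_base _ hp) a b).comp p
    (hγ.contDiffAt_hopfCylinder hp)

lemma differentiableAt_hopfFrame (hγ : IsBaseCurve m I x y) (hp : p 0 ∈ I) (a b : Fin 3) :
    DifferentiableAt ℝ (fun q => hopfFrame m l x y q a b) p :=
  (contDiffAt_matrix_mul (hγ.contDiffAt_bcvFrame_comp hp)
    (hγ.contDiffAt_rotation hp) a b).differentiableAt (by simp)

lemma pdMatrix_rotation (hγ : IsBaseCurve m I x y) (hp : p 0 ∈ I) (i : Fin 2) :
    pdMatrix i (fun q => verticalRotation (tangentX m x y (q 0)) (tangentY m x y (q 0))) p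
      = verticalRotation (tangentX m x y (p 0)) (tangentY m x y (p 0))
        * crossMatrix (![![0, 0, geodesicCurvature m x y (p 0) - 2 * m *
          (y (p 0) * tangentX m x y (p 0) - x (p 0) * tangentY m x y (p 0))], 0] i) := by
  obtain ⟨hu, hv⟩ := hγ.contDiffAt_tangent hp
  obtain ⟨hu', hv'⟩ := hγ.deriv_tangent hp
  have hX (i : Fin 2) := pd_comp_coord i 0 (hu.differentiableAt (by simp)).hasDerivAt
  have hY (i : Fin 2) := pd_comp_coord i 0 (hv.differentiableAt (by simp)).hasDerivAt
  simp only [hu'] at hX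
  simp only [hv'] at hY
  ext a b
  fin_cases i <;> fin_cases a <;> fin_cases b <;>
    simp [pdMatrix, verticalRotation, crossMatrix_apply, mul_apply, Fin.sum_univ_three, pd_const,
      pd_neg, hX, hY] <;> ring

lemma sum_bcvConnection_hopfCylinder (hγ : IsBaseCurve m I x y) (hp : p 0 ∈ I) (i : Fin 2) :
    ∑ b, pd i (fun q => hopfCylinder x y q b) p • bcvConnection m l b (hopfCylinder x y p)
      = verticalRotation (tangentX m x y (p 0)) (tangentY m x y (p 0)) *ᵥ
        ![![l / 2, 0, (2 * m - l ^ 2 / 4) *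
            (y (p 0) * tangentX m x y (p 0) - x (p 0) * tangentY m x y (p 0))],
          ![0, 0, -(l / 2)]] i := by
  obtain ⟨hx', hy'⟩ := hγ.deriv_eq_factor_mul_tangent hp
  have hpd (b : Fin 3) := congrFun (hγ.pdVec_hopfCylinder hp i) b
  have hfactor := (hγ.mem_base _ hp).ne'
  simp only [pdVec] at hpd
  simp only [hpd, hx', hy']
  ext b
  fin_cases i <;> fin_cases b <;>
    simp [bcvConnection, hopfCylinder, verticalRotation, mulVec, dotProduct, Fin.sum_univ_three,
      -one_div] <;> field_simp
  ring

lemma pullbackConnection_hopfFrame (hγ : IsBaseCurve m I x y) (hp : p 0 ∈ I) (i : Fin 2) :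
    pdMatrix i (hopfFrame m l x y) p
        + pullbackConnection (bcvMetric m l) (hopfCylinder x y) i p * hopfFrame m l x y p
      = hopfFrame m l x y p * crossMatrix (![![l / 2, 0,
          geodesicCurvature m x y (p 0) - l / 2 * verticalComponent m l x y (p 0)],
          ![0, 0, -(l / 2)]] i) := by
  have hφ := (hγ.contDiffAt_hopfCylinder hp).differentiableAt (by simp)
  refine pdMatrix_mul_add i
    (fun a b => (hγ.contDiffAt_bcvFrame_comp hp a b).differentiableAt (by simp))
    (fun a b => (hγ.contDiffAt_rotation hp a b).differentiableAt (by simp))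
    ((isCartanFrame_bcvFrame m l).pdMatrix_frame_comp_add (hγ.mem_base _ hp) hφ i) ?_
  simp only [← map_smul, ← map_sum]
  rw [hγ.pdMatrix_rotation hp, hγ.sum_bcvConnection_hopfCylinder hp,
    crossMatrix_mul_verticalRotation (hγ.tangent_sq_add_sq hp), ← Matrix.mul_add, ← map_add]
  congr 2
  unfold verticalComponent
  fin_cases i <;> simp
  ring

end IsBaseCurve

end HopfCylinder

section InducedMetric

variable {m l : ℝ} {I : Set ℝ} {x y : ℝ → ℝ} {p : Fin 2 → ℝ}

lemma pullbackMetric_apply {k n : ℕ} {h : (Fin n → ℝ) → Matrix (Fin n) (Fin n) ℝ}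
    {φ : (Fin k → ℝ) → Fin n → ℝ} {p : Fin k → ℝ} (i j : Fin k) :
    pullbackMetric h φ p i j = pdVec i φ p ⬝ᵥ h (φ p) *ᵥ pdVec j φ p := by
  simp only [pullbackMetric, of_apply, dotProduct, mulVec, pdVec, Finset.mul_sum]
  exact Finset.sum_congr rfl fun a _ => Finset.sum_congr rfl fun b _ => by ring

namespace IsBaseCurve

lemma hopfFrame_orthonormal (hγ : IsBaseCurve m I x y) (hp : p 0 ∈ I) (v w : Fin 3 → ℝ) :
    (hopfFrame m l x y p *ᵥ v) ⬝ᵥ bcvMetric m l (hopfCylinder x y p) *ᵥ hopfFrame m l x y p *ᵥ w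
      = v ⬝ᵥ w := by
  have hcoframe : bcvCoframe m l (hopfCylinder x y p) * hopfFrame m l x y p
      = verticalRotation (tangentX m x y (p 0)) (tangentY m x y (p 0)) := by
    rw [hopfFrame, ← Matrix.mul_assoc, bcvCoframe_mul_bcvFrame (hγ.mem_base _ hp).ne',
      Matrix.one_mul]
  have hmetric : (hopfFrame m l x y p)ᵀ * bcvMetric m l (hopfCylinder x y p)
      * hopfFrame m l x y p = 1 := by
    rw [bcvMetric, ← Matrix.mul_assoc, ← transpose_mul, Matrix.mul_assoc, hcoframe,
      transpose_verticalRotation_mul_self (hγ.tangent_sq_add_sq hp)]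
  rw [← vecMul_transpose, ← dotProduct_mulVec, mulVec_mulVec, mulVec_mulVec, hmetric,
    one_mulVec]

lemma isCartanFrame_hopfCylinder (hγ : IsBaseCurve m I x y) :
    IsCartanFrame (pullbackMetric (bcvMetric m l) (hopfCylinder x y))
      (fun q => !![1, 0; verticalComponent m l x y (q 0), 1])
      (fun q => !![1, 0; -verticalComponent m l x y (q 0), 1]) (fun _ _ => 0)
      {q | q 0 ∈ I} where
  isOpen := hγ.isOpen.preimage (continuous_apply 0)
  smooth_coframe p hp a b := by
    have hv := contDiffAt_comp_coord (hγ.contDiffAt_verticalComponent (l := l) hp)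
    fin_cases a <;> fin_cases b <;> simp <;> fun_prop
  smooth_frame p hp a b := by
    have hv := contDiffAt_comp_coord (hγ.contDiffAt_verticalComponent (l := l) hp)
    fin_cases a <;> fin_cases b <;> simp <;> fun_prop
  smooth_connection _ _ _ _ _ := contDiffAt_const
  metric_eq p hp := by
    ext i j
    rw [pullbackMetric_apply, hγ.pdVec_hopfCylinder_eq_mulVec (l := l) hp,
      hγ.pdVec_hopfCylinder_eq_mulVec (l := l) hp, hγ.hopfFrame_orthonormal hp]
    fin_cases i <;> fin_cases j <;> simp [mul_apply, Fin.sum_univ_two]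
  coframe_mul_frame p _ := by
    ext i j
    fin_cases i <;> fin_cases j <;> simp [mul_apply, Fin.sum_univ_two]
  skew _ _ _ := by simp
  structure_eq p hp i j a := by
    have hpd (i : Fin 2) := pd_comp_coord i 0
      ((hγ.contDiffAt_verticalComponent (l := l) hp).differentiableAt (by simp)).hasDerivAt
    fin_cases i <;> fin_cases j <;> fin_cases a <;> simp [pdMatrix, pd_const, hpd]

end IsBaseCurve

/-- The covariant derivative along `T = ∂ₛ - verticalComponent • ∂_z` of a vector field along the
Hopf cylinder, in terms of its components `w` in the frame `hopfFrame`. -/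
noncomputable def covTangent (m l : ℝ) (x y : ℝ → ℝ) (w : (Fin 2 → ℝ) → Fin 3 → ℝ)
    (p : Fin 2 → ℝ) : Fin 3 → ℝ :=
  pdVec 0 w p - verticalComponent m l x y (p 0) • pdVec 1 w p
    + ![l / 2, 0, geodesicCurvature m x y (p 0)] ⨯₃ w p

/-- The covariant derivative along `ξ = ∂_z` of a vector field along a Hopf cylinder, in terms of
its components `w` in the frame `hopfFrame`. -/
noncomputable def covVertical (l : ℝ) (w : (Fin 2 → ℝ) → Fin 3 → ℝ) (p : Fin 2 → ℝ) :
    Fin 3 → ℝ :=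
  pdVec 1 w p + ![0, 0, -(l / 2)] ⨯₃ w p

namespace IsBaseCurve

lemma covDeriv_zero_hopfFrame_mulVec (hγ : IsBaseCurve m I x y) (hp : p 0 ∈ I)
    {w : (Fin 2 → ℝ) → Fin 3 → ℝ} (hw : ∀ b, DifferentiableAt ℝ (fun q => w q b) p) :
    covDeriv (bcvMetric m l) (hopfCylinder x y) 0 (fun q => hopfFrame m l x y q *ᵥ w q) p
      = hopfFrame m l x y p *ᵥ
        (covTangent m l x y w p + verticalComponent m l x y (p 0) • covVertical l w p) := by
  have hsplit : (![l / 2, 0, geodesicCurvature m x y (p 0)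
        - l / 2 * verticalComponent m l x y (p 0)] : Fin 3 → ℝ)
      = ![l / 2, 0, geodesicCurvature m x y (p 0)]
        + verticalComponent m l x y (p 0) • ![0, 0, -(l / 2)] := by
    simp
    ring
  rw [covDeriv_mulVec 0 (hγ.differentiableAt_hopfFrame hp) hw
    (hγ.pullbackConnection_hopfFrame hp 0), crossMatrix_mulVec, cons_val_zero, hsplit, map_add,
    LinearMap.add_apply, map_smul, LinearMap.smul_apply, covTangent, covVertical]
  congr 1
  module

lemma covDeriv_one_hopfFrame_mulVec (hγ : IsBaseCurve m I x y) (hp : p 0 ∈ I)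
    {w : (Fin 2 → ℝ) → Fin 3 → ℝ} (hw : ∀ b, DifferentiableAt ℝ (fun q => w q b) p) :
    covDeriv (bcvMetric m l) (hopfCylinder x y) 1 (fun q => hopfFrame m l x y q *ᵥ w q) p
      = hopfFrame m l x y p *ᵥ covVertical l w p := by
  rw [covDeriv_mulVec 1 (hγ.differentiableAt_hopfFrame hp) hw
    (hγ.pullbackConnection_hopfFrame hp 1), crossMatrix_mulVec]
  rfl

lemma divergence_hopfCylinder (hγ : IsBaseCurve m I x y) (hp : p 0 ∈ I)
    {Z : Fin 2 → (Fin 2 → ℝ) → Fin 3 → ℝ} {v w : (Fin 2 → ℝ) → Fin 3 → ℝ}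
    (hZ₀ : Z 0 =ᶠ[𝓝 p] fun q =>
      hopfFrame m l x y q *ᵥ (v q + verticalComponent m l x y (q 0) • w q))
    (hZ₁ : Z 1 =ᶠ[𝓝 p] fun q => hopfFrame m l x y q *ᵥ w q)
    (hv : ∀ b, DifferentiableAt ℝ (fun q => v q b) p)
    (hw : ∀ b, DifferentiableAt ℝ (fun q => w q b) p) :
    divergence (pullbackMetric (bcvMetric m l) (hopfCylinder x y)) (bcvMetric m l)
        (hopfCylinder x y) Z p
      = hopfFrame m l x y p *ᵥ (covTangent m l x y v p + covVertical l w p) := by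
  have ha := (contDiffAt_comp_coord
    (hγ.contDiffAt_verticalComponent (l := l) hp)).differentiableAt (by simp)
  have hZ (i b) : DifferentiableAt ℝ (fun q => Z i q b) p := by
    fin_cases i
    · exact (differentiableAt_mulVec (hγ.differentiableAt_hopfFrame hp)
        (fun b => (hv b).fun_add (ha.fun_mul (hw b))) b).congr_of_eventuallyEq
        (hZ₀.fun_comp (· b))
    · exact (differentiableAt_mulVec (hγ.differentiableAt_hopfFrame hp) hw
        b).congr_of_eventuallyEq (hZ₁.fun_comp (· b))
  have hframe (j) : (fun q => ∑ i, !![1, 0; -verticalComponent m l x y (q 0), 1] i j • Z i q)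
      =ᶠ[𝓝 p] fun q => hopfFrame m l x y q *ᵥ ![v, w] j q := by
    filter_upwards [hZ₀, hZ₁] with q h₀ h₁
    fin_cases j <;> simp [Fin.sum_univ_two, h₀, h₁, mulVec_add, mulVec_smul]
  rw [hγ.isCartanFrame_hopfCylinder.divergence_eq hp hZ]
  simp only [covDeriv_congr _ (hframe _)]
  simp [Fin.sum_univ_two, hγ.covDeriv_zero_hopfFrame_mulVec hp hv,
    hγ.covDeriv_one_hopfFrame_mulVec hp hv,
    hγ.covDeriv_one_hopfFrame_mulVec hp hw, mulVec_add, mulVec_smul]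

end IsBaseCurve

end InducedMetric

section ConformalHopfCylinder

variable {m l : ℝ} {I : Set ℝ} {x y : ℝ → ℝ} {f : (Fin 2 → ℝ) → ℝ} {p : Fin 2 → ℝ}

/-- The metric `f⁻¹ φ^* h` on the Hopf cylinder, with `φ` its inclusion into the BCV space. -/
noncomputable def conformalMetric (m l : ℝ) (x y : ℝ → ℝ) (f : (Fin 2 → ℝ) → ℝ)
    (p : Fin 2 → ℝ) : Matrix (Fin 2) (Fin 2) ℝ :=
  (f p)⁻¹ • pullbackMetric (bcvMetric m l) (hopfCylinder x y) p

/-- The derivative along `T = ∂ₛ - verticalComponent • ∂_z` of a function on the Hopf cylinder. -/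
noncomputable def tangentDeriv (m l : ℝ) (x y : ℝ → ℝ) (u : (Fin 2 → ℝ) → ℝ) (p : Fin 2 → ℝ) : ℝ :=
  pd 0 u p - verticalComponent m l x y (p 0) * pd 1 u p

lemma covTangent_vec3 (u v w : (Fin 2 → ℝ) → ℝ) (p : Fin 2 → ℝ) :
    covTangent m l x y (fun q => ![u q, v q, w q]) p
      = ![tangentDeriv m l x y u p - geodesicCurvature m x y (p 0) * v p,
          tangentDeriv m l x y v p + geodesicCurvature m x y (p 0) * u p - l / 2 * w p,
          tangentDeriv m l x y w p + l / 2 * v p] := by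
  ext b
  fin_cases b <;> simp [covTangent, tangentDeriv, pdVec, cross_apply, sub_eq_add_neg, add_assoc]

lemma covVertical_vec3 (u v w : (Fin 2 → ℝ) → ℝ) (p : Fin 2 → ℝ) :
    covVertical l (fun q => ![u q, v q, w q]) p
      = ![pd 1 u p + l / 2 * v p, pd 1 v p - l / 2 * u p, pd 1 w p] := by
  ext b
  fin_cases b <;> simp [covVertical, pdVec, cross_apply, sub_eq_add_neg]

namespace IsBaseCurve

lemma divergence_conformalMetric (hγ : IsBaseCurve m I x y) (hp : p 0 ∈ I)
    (hf : DifferentiableAt ℝ f p) (hf0 : f p ≠ 0)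
    {Z : Fin 2 → (Fin 2 → ℝ) → Fin 3 → ℝ} {v w : (Fin 2 → ℝ) → Fin 3 → ℝ}
    (hZ₀ : Z 0 =ᶠ[𝓝 p] fun q =>
      hopfFrame m l x y q *ᵥ (v q + verticalComponent m l x y (q 0) • w q))
    (hZ₁ : Z 1 =ᶠ[𝓝 p] fun q => hopfFrame m l x y q *ᵥ w q)
    (hv : ∀ b, DifferentiableAt ℝ (fun q => v q b) p)
    (hw : ∀ b, DifferentiableAt ℝ (fun q => w q b) p) :
    divergence (conformalMetric m l x y f) (bcvMetric m l) (hopfCylinder x y) Z p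
      = hopfFrame m l x y p *ᵥ (f p • (covTangent m l x y v p + covVertical l w p)) := by
  have hC := hγ.isCartanFrame_hopfCylinder (l := l)
  refine (divergence_smul_of_surface (hf.fun_inv hf0) (inv_ne_zero hf0)
    (hC.differentiableAt_metric hp) (hC.isUnit_det_metric hp) (hC.isSymm_metric hp)).trans ?_
  rw [inv_inv, hγ.divergence_hopfCylinder hp hZ₀ hZ₁ hv hw, mulVec_smul]

lemma eventually_mem (hγ : IsBaseCurve m I x y) (hp : p 0 ∈ I) : ∀ᶠ q in 𝓝 p, q 0 ∈ I :=
  (continuous_apply 0).continuousAt.eventually (hγ.isOpen.mem_nhds hp)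

lemma eventually_contDiffAt_mul_geodesicCurvature (hγ : IsBaseCurve m I x y) (hp : p 0 ∈ I)
    (hf : ∀ᶠ q in 𝓝 p, ContDiffAt ℝ ∞ f q) :
    ∀ᶠ q in 𝓝 p, ContDiffAt ℝ ∞ (fun q => f q * geodesicCurvature m x y (q 0)) q := by
  filter_upwards [hγ.eventually_mem hp, hf] with q hq hfq
  exact hfq.mul (contDiffAt_comp_coord (hγ.contDiffAt_geodesicCurvature hq))

lemma tension_conformalMetric (hγ : IsBaseCurve m I x y) (hp : p 0 ∈ I)
    (hf : DifferentiableAt ℝ f p) (hf0 : f p ≠ 0) :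
    tension (conformalMetric m l x y f) (bcvMetric m l) (hopfCylinder x y) p
      = hopfFrame m l x y p *ᵥ ![0, f p * geodesicCurvature m x y (p 0), 0] := by
  have hframe (i : Fin 2) : pdVec i (hopfCylinder x y) =ᶠ[𝓝 p] fun q => hopfFrame m l x y q *ᵥ
      ![![1, 0, verticalComponent m l x y (q 0)], ![0, 0, 1]] i := by
    filter_upwards [hγ.eventually_mem hp] with q hq
    exact hγ.pdVec_hopfCylinder_eq_mulVec hq i
  rw [tension_eq_divergence, hγ.divergence_conformalMetric (v := fun _ => ![1, 0, 0])
    (w := fun _ => ![0, 0, 1]) hp hf hf0 ((hframe 0).trans (.of_eq (by simp))) (hframe 1)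
    (fun _ => differentiableAt_const _) (fun _ => differentiableAt_const _)]
  congr 1
  ext b
  fin_cases b <;> simp [covTangent, covVertical, pdVec_const, cross_apply]

lemma curvatureOperator_hopfFrame (hγ : IsBaseCurve m I x y) (hp : p 0 ∈ I)
    (u v w : Fin 3 → ℝ) :
    curvatureOperator (bcvMetric m l) (hopfCylinder x y p) (hopfFrame m l x y p *ᵥ u)
        (hopfFrame m l x y p *ᵥ v) *ᵥ (hopfFrame m l x y p *ᵥ w)
      = -(hopfFrame m l x y p *ᵥ ((bcvCurvature m l * (u ⨯₃ v)) ⨯₃ w)) := by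
  have hrotation := hγ.tangent_sq_add_sq hp
  have hcommute (u v z : _) : bcvCurvature m l * (verticalRotation u v *ᵥ z)
      = verticalRotation u v *ᵥ (bcvCurvature m l * z) := by
    ext b
    fin_cases b <;>
      simp [bcvCurvature, verticalRotation, mulVec, dotProduct, Fin.sum_univ_three] <;> ring
  simp only [hopfFrame, ← mulVec_mulVec]
  rw [curvatureOperator_bcvMetric (hγ.mem_base _ hp), verticalRotation_mulVec_cross hrotation,
    hcommute, verticalRotation_mulVec_cross hrotation]

lemma curvatureTrace_conformalMetric (hγ : IsBaseCurve m I x y) (hp : p 0 ∈ I) (hf0 : f p ≠ 0)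
    {W : (Fin 2 → ℝ) → Fin 3 → ℝ} {w : ℝ} (hW : W p = hopfFrame m l x y p *ᵥ ![0, w, 0]) :
    curvatureTrace (conformalMetric m l x y f) (bcvMetric m l) (hopfCylinder x y) W p
      = hopfFrame m l x y p *ᵥ (f p • ![0, -((4 * m - l ^ 2 / 2) * w), 0]) := by
  have hC := hγ.isCartanFrame_hopfCylinder (l := l)
  have hinv : (conformalMetric m l x y f p)⁻¹
      = f p • (!![1, 0; -verticalComponent m l x y (p 0), 1]
        * !![1, 0; -verticalComponent m l x y (p 0), 1]ᵀ) := by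
    rw [conformalMetric, matrix_inv_smul (inv_ne_zero hf0) (hC.isUnit_det_metric hp), inv_inv,
      hC.inv_metric hp]
  have hframe (j : Fin 2) : ∑ i, !![1, 0; -verticalComponent m l x y (p 0), 1] i j
        • pdVec i (hopfCylinder x y) p
      = hopfFrame m l x y p *ᵥ ![![1, 0, 0], ![0, 0, 1]] j := by
    simp only [Fin.sum_univ_two, hγ.pdVec_hopfCylinder_eq_mulVec (l := l) hp, ← mulVec_smul,
      ← mulVec_add]
    fin_cases j <;> simp
  rw [curvatureTrace_eq_of_inv hinv]
  simp only [hframe, hW, hγ.curvatureOperator_hopfFrame hp, ← mulVec_neg, ← mulVec_sum,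
    ← mulVec_smul]
  congr 2
  ext b
  fin_cases b <;> simp [Fin.sum_univ_two, bcvCurvature, cross_apply]
  ring

end IsBaseCurve

end ConformalHopfCylinder

section Bitension

variable {m l : ℝ} {I : Set ℝ} {x y : ℝ → ℝ} {f w : (Fin 2 → ℝ) → ℝ} {p : Fin 2 → ℝ}

lemma covTangent_normal (w : (Fin 2 → ℝ) → ℝ) (p : Fin 2 → ℝ) :
    covTangent m l x y (fun q => ![0, w q, 0]) p
      = ![-(geodesicCurvature m x y (p 0) * w p), tangentDeriv m l x y w p, l / 2 * w p] := by
  simp [covTangent_vec3 (fun _ => 0) w (fun _ => 0), tangentDeriv, pd_const]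

lemma covVertical_normal (w : (Fin 2 → ℝ) → ℝ) (p : Fin 2 → ℝ) :
    covVertical l (fun q => ![0, w q, 0]) p = ![l / 2 * w p, pd 1 w p, 0] := by
  simp [covVertical_vec3 (fun _ => 0) w (fun _ => 0), pd_const]

lemma covVertical_covVertical_normal (w : (Fin 2 → ℝ) → ℝ) (p : Fin 2 → ℝ) :
    covVertical l (covVertical l fun q => ![0, w q, 0]) p
      = ![l * pd 1 w p, pd 1 (pd 1 w) p - l ^ 2 / 4 * w p, 0] := by
  simp only [funext (covVertical_normal w), covVertical_vec3, pd_const_mul, pd_const]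
  ext b
  fin_cases b <;> simp <;> ring

lemma tangentDeriv_comp_coord_mul {κ : ℝ → ℝ} (hκ : DifferentiableAt ℝ κ (p 0))
    (hw : DifferentiableAt ℝ w p) :
    tangentDeriv m l x y (fun q => κ (q 0) * w q) p
      = deriv κ (p 0) * w p + κ (p 0) * tangentDeriv m l x y w p := by
  have hκ0 : DifferentiableAt ℝ (fun q : Fin 2 → ℝ => κ (q 0)) p :=
    hκ.comp p (differentiableAt_apply 0 p)
  simp only [tangentDeriv, pd_mul _ hκ0 hw, pd_comp_coord _ _ hκ.hasDerivAt]
  simp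
  ring

/-- The components in the frame `hopfFrame` of the bitension field of the Hopf cylinder with the
metric `f⁻¹ φ^* h`, divided by `f`; here `w` is the component of the tension field along `N`. -/
noncomputable def bitensionComponents (m l : ℝ) (x y : ℝ → ℝ) (w : (Fin 2 → ℝ) → ℝ)
    (p : Fin 2 → ℝ) : Fin 3 → ℝ :=
  ![l * pd 1 w p - 2 * geodesicCurvature m x y (p 0) * tangentDeriv m l x y w p
      - deriv (geodesicCurvature m x y) (p 0) * w p,
    tangentDeriv m l x y (tangentDeriv m l x y w) p + pd 1 (pd 1 w) p
      - (geodesicCurvature m x y (p 0) ^ 2 + l ^ 2 - 4 * m) * w p,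
    l * tangentDeriv m l x y w p]

namespace IsBaseCurve

lemma covTangent_covTangent_normal (hγ : IsBaseCurve m I x y) (hp : p 0 ∈ I)
    (hw : DifferentiableAt ℝ w p) :
    covTangent m l x y (covTangent m l x y fun q => ![0, w q, 0]) p
      = ![-(2 * geodesicCurvature m x y (p 0) * tangentDeriv m l x y w p
            + deriv (geodesicCurvature m x y) (p 0) * w p),
          tangentDeriv m l x y (tangentDeriv m l x y w) p
            - (geodesicCurvature m x y (p 0) ^ 2 + l ^ 2 / 4) * w p,
          l * tangentDeriv m l x y w p] := by
  have hfirst : tangentDeriv m l x y (fun q => -(geodesicCurvature m x y (q 0) * w q)) p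
      = -tangentDeriv m l x y (fun q => geodesicCurvature m x y (q 0) * w q) p := by
    simp only [tangentDeriv, pd_neg]
    ring
  have hthird : tangentDeriv m l x y (fun q => l / 2 * w q) p
      = l / 2 * tangentDeriv m l x y w p := by
    simp only [tangentDeriv, pd_const_mul]
    ring
  rw [funext (covTangent_normal w), covTangent_vec3, hfirst, hthird, tangentDeriv_comp_coord_mul
    ((hγ.contDiffAt_geodesicCurvature hp).differentiableAt (by simp)) hw]
  ext b
  fin_cases b <;> simp <;> ring

lemma contDiffAt_tangentDeriv (hγ : IsBaseCurve m I x y) (hp : p 0 ∈ I) (hw : ContDiffAt ℝ ∞ w p) :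
    ContDiffAt ℝ ∞ (tangentDeriv m l x y w) p :=
  (contDiffAt_pd 0 hw).sub
    ((contDiffAt_comp_coord (hγ.contDiffAt_verticalComponent hp)).mul (contDiffAt_pd 1 hw))

lemma roughLaplacian_conformalMetric (hγ : IsBaseCurve m I x y) (hp : p 0 ∈ I)
    (hf : DifferentiableAt ℝ f p) (hf0 : f p ≠ 0) (hw : ∀ᶠ q in 𝓝 p, ContDiffAt ℝ ∞ w q)
    {W : (Fin 2 → ℝ) → Fin 3 → ℝ}
    (hW : W =ᶠ[𝓝 p] fun q => hopfFrame m l x y q *ᵥ ![0, w q, 0]) :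
    roughLaplacian (conformalMetric m l x y f) (bcvMetric m l) (hopfCylinder x y) W p
      = hopfFrame m l x y p *ᵥ (f p •
        (covTangent m l x y (covTangent m l x y fun q => ![0, w q, 0]) p
          + covVertical l (covVertical l fun q => ![0, w q, 0]) p)) := by
  have hdiff : ∀ᶠ q in 𝓝 p, ∀ b,
      DifferentiableAt ℝ (fun r => (![0, w r, 0] : Fin 3 → ℝ) b) q := by
    filter_upwards [hw] with q hq b
    fin_cases b
    exacts [differentiableAt_const _, hq.differentiableAt (by simp), differentiableAt_const _]
  have hwp := hw.self_of_nhds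
  have hwd : DifferentiableAt ℝ w p := hwp.differentiableAt (by simp)
  have hκ := (contDiffAt_comp_coord (hγ.contDiffAt_geodesicCurvature hp)).differentiableAt (by simp)
  rw [roughLaplacian_eq_divergence]
  refine hγ.divergence_conformalMetric hp hf hf0 ?_ ?_ ?_ ?_
  · filter_upwards [hγ.eventually_mem hp, hdiff, hW.eventuallyEq_nhds] with q hq hdiffq hWq
    rw [covDeriv_congr 0 hWq, hγ.covDeriv_zero_hopfFrame_mulVec hq hdiffq]
  · filter_upwards [hγ.eventually_mem hp, hdiff, hW.eventuallyEq_nhds] with q hq hdiffq hWq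
    rw [covDeriv_congr 1 hWq, hγ.covDeriv_one_hopfFrame_mulVec hq hdiffq]
  · intro b
    simp only [covTangent_normal]
    fin_cases b
    exacts [(hκ.fun_mul hwd).fun_neg,
      (hγ.contDiffAt_tangentDeriv hp hwp).differentiableAt (by simp), hwd.const_mul _]
  · intro b
    simp only [covVertical_normal]
    fin_cases b
    exacts [hwd.const_mul _, (contDiffAt_pd 1 hwp).differentiableAt (by simp),
      differentiableAt_const _]

lemma bitension_conformalMetric (hγ : IsBaseCurve m I x y) (hp : p 0 ∈ I)
    (hf : ∀ᶠ q in 𝓝 p, ContDiffAt ℝ ∞ f q ∧ f q ≠ 0) :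
    bitension (conformalMetric m l x y f) (bcvMetric m l) (hopfCylinder x y) p
      = hopfFrame m l x y p *ᵥ (f p • bitensionComponents m l x y
        (fun q => f q * geodesicCurvature m x y (q 0)) p) := by
  have htension : tension (conformalMetric m l x y f) (bcvMetric m l) (hopfCylinder x y) =ᶠ[𝓝 p]
      fun q => hopfFrame m l x y q *ᵥ ![0, f q * geodesicCurvature m x y (q 0), 0] := by
    filter_upwards [hγ.eventually_mem hp, hf] with q hq hfq
    exact hγ.tension_conformalMetric hq (hfq.1.differentiableAt (by simp)) hfq.2
  have hw := hγ.eventually_contDiffAt_mul_geodesicCurvature hp (hf.mono fun _ => And.left)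
  obtain ⟨hfp, hf0⟩ := hf.self_of_nhds
  change roughLaplacian _ _ _ _ p - curvatureTrace _ _ _ _ p = _
  rw [hγ.roughLaplacian_conformalMetric hp (hfp.differentiableAt (by simp)) hf0 hw htension,
    hγ.curvatureTrace_conformalMetric hp hf0 htension.eq_of_nhds, ← mulVec_sub, ← smul_sub,
    hγ.covTangent_covTangent_normal hp (hw.self_of_nhds.differentiableAt (by simp)),
    covVertical_covVertical_normal]
  congr 2
  ext b
  fin_cases b <;> simp [bitensionComponents] <;> ring

end IsBaseCurve

end Bitension

section Rigidity

variable {m l : ℝ} {I : Set ℝ} {x y k : ℝ → ℝ} {u v w : (Fin 2 → ℝ) → ℝ} {p : Fin 2 → ℝ}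

lemma tangentDeriv_congr (h : u =ᶠ[𝓝 p] v) :
    tangentDeriv m l x y u p = tangentDeriv m l x y v p := by
  rw [tangentDeriv, tangentDeriv, pd_congr 0 h, pd_congr 1 h]

lemma IsBaseCurve.tangentDeriv_pd_one (hγ : IsBaseCurve m I x y) (hp : p 0 ∈ I)
    (hw : ContDiffAt ℝ ∞ w p) :
    tangentDeriv m l x y (pd 1 w) p = pd 1 (tangentDeriv m l x y w) p := by
  have ha := hγ.contDiffAt_verticalComponent (l := l) hp
  have ha0 := (contDiffAt_comp_coord ha).differentiableAt (by simp)
  have hdiff (i) : DifferentiableAt ℝ (pd i w) p := (contDiffAt_pd i hw).differentiableAt (by simp)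
  have hright : pd 1 (tangentDeriv m l x y w) p
      = pd 1 (fun q => pd 0 w q - verticalComponent m l x y (q 0) * pd 1 w q) p := rfl
  rw [hright, pd_sub 1 (hdiff 0) (ha0.fun_mul (hdiff 1)), pd_mul 1 ha0 (hdiff 1),
    pd_comp_coord 1 0 (ha.differentiableAt (by simp)).hasDerivAt, tangentDeriv, pd_comm 0 1 hw]
  simp

lemma IsBaseCurve.deriv_mul_eq_zero (hγ : IsBaseCurve m I x y) (hp : p 0 ∈ I)
    (hw : ContDiffAt ℝ ∞ w p) (hk : DifferentiableAt ℝ k (p 0))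
    (hT : tangentDeriv m l x y w =ᶠ[𝓝 p] fun _ => 0)
    (hξ : (fun q => l * pd 1 w q) =ᶠ[𝓝 p] fun q => k (q 0) * w q) : deriv k (p 0) * w p = 0 := by
  have hcomm : tangentDeriv m l x y (fun q => l * pd 1 w q) p = 0 := by
    have hconst : tangentDeriv m l x y (fun q => l * pd 1 w q) p
        = l * tangentDeriv m l x y (pd 1 w) p := by
      simp only [tangentDeriv, pd_const_mul]
      ring
    rw [hconst, hγ.tangentDeriv_pd_one hp hw, pd_congr 1 hT, pd_const, mul_zero]
  rwa [tangentDeriv_congr hξ, tangentDeriv_comp_coord_mul hk (hw.differentiableAt (by simp)),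
    hT.eq_of_nhds, mul_zero, add_zero] at hcomm

lemma sq_mul_pd_one_pd_one (hw : DifferentiableAt ℝ w p) (hk : DifferentiableAt ℝ k (p 0))
    (hξ : (fun q => l * pd 1 w q) =ᶠ[𝓝 p] fun q => k (q 0) * w q) :
    l ^ 2 * pd 1 (pd 1 w) p = k (p 0) ^ 2 * w p := by
  have hk0 : DifferentiableAt ℝ (fun q : Fin 2 → ℝ => k (q 0)) p :=
    hk.comp p (differentiableAt_apply 0 p)
  have hderiv : l * pd 1 (pd 1 w) p = k (p 0) * pd 1 w p := by
    rw [← pd_const_mul, pd_congr 1 hξ, pd_mul 1 hk0 hw, pd_comp_coord 1 0 hk.hasDerivAt]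
    simp
  linear_combination l * hderiv + k (p 0) * hξ.eq_of_nhds

lemma sq_add_eq_zero_of_deriv_sq_eq {κ : ℝ → ℝ} {a c s : ℝ} (ha : a ≠ 0)
    (hκ : DifferentiableAt ℝ κ s) (hκ' : DifferentiableAt ℝ (deriv κ) s)
    (hsecond : deriv (deriv κ) s = 0) (hode : ∀ᶠ t in 𝓝 s, deriv κ t ^ 2 = a * (κ t ^ 2 + c))
    (hs : κ s ≠ 0) : κ s ^ 2 + c = 0 := by
  have hleft := (hκ'.hasDerivAt.fun_pow 2).congr_of_eventuallyEq (hode.mono fun _ => Eq.symm)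
  have hderiv := hleft.unique (((hκ.hasDerivAt.fun_pow 2).add_const c).const_mul a)
  have hconst : deriv κ s = 0 := by
    simpa [hsecond, ha, hs] using hderiv
  simpa [hconst, ha] using hode.self_of_nhds

lemma IsBaseCurve.geodesicCurvature_sq (hγ : IsBaseCurve m I x y) (hp : p 0 ∈ I) (hl : l ≠ 0)
    (hw : ∀ᶠ q in 𝓝 p, ContDiffAt ℝ ∞ w q)
    (hbitension : ∀ᶠ q in 𝓝 p, bitensionComponents m l x y w q = 0) (hw0 : w p ≠ 0)
    (hκ0 : geodesicCurvature m x y (p 0) ≠ 0) :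
    geodesicCurvature m x y (p 0) ^ 2 = 4 * m - l ^ 2 := by
  have hκ := hγ.contDiffAt_geodesicCurvature hp
  have hκ' {s} (hs : s ∈ I) : DifferentiableAt ℝ (deriv (geodesicCurvature m x y)) s :=
    ((hγ.contDiffAt_geodesicCurvature hs).derivWithin (m := ∞) le_rfl).differentiableAt (by simp)
  have hT : tangentDeriv m l x y w =ᶠ[𝓝 p] fun _ => 0 := by
    filter_upwards [hbitension] with q hq
    simpa [bitensionComponents, hl] using congrFun hq 2
  have hξ : (fun q => l * pd 1 w q) =ᶠ[𝓝 p]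
      fun q => deriv (geodesicCurvature m x y) (q 0) * w q := by
    filter_upwards [hbitension, hT] with q hq hTq
    simpa [bitensionComponents, hTq, sub_eq_zero] using congrFun hq 0
  have hode : ∀ᶠ q in 𝓝 p, deriv (geodesicCurvature m x y) (q 0) ^ 2
      = l ^ 2 * (geodesicCurvature m x y (q 0) ^ 2 + (l ^ 2 - 4 * m)) := by
    have hne := hw.self_of_nhds.continuousAt.eventually_ne hw0
    filter_upwards [hγ.eventually_mem hp, hbitension, hT.eventuallyEq_nhds,
      hξ.eventuallyEq_nhds, hw, hne] with q hqI hq hTq hξq hwq hwq0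
    have hTT : tangentDeriv m l x y (tangentDeriv m l x y w) q = 0 := by
      rw [tangentDeriv_congr hTq]
      simp [tangentDeriv, pd_const]
    have hN : pd 1 (pd 1 w) q - (geodesicCurvature m x y (q 0) ^ 2 + l ^ 2 - 4 * m) * w q = 0 := by
      simpa [bitensionComponents, hTT] using congrFun hq 1
    have hξξ := sq_mul_pd_one_pd_one (hwq.differentiableAt (by simp)) (hκ' hqI) hξq
    refine mul_right_cancel₀ hwq0 ?_
    linear_combination l ^ 2 * hN - hξξ
  have hsecond : deriv (deriv (geodesicCurvature m x y)) (p 0) = 0 :=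
    (mul_eq_zero.1 (hγ.deriv_mul_eq_zero hp hw.self_of_nhds (hκ' hp) hT hξ)).resolve_right hw0
  have hode' : ∀ᶠ s in 𝓝 (p 0), deriv (geodesicCurvature m x y) s ^ 2
      = l ^ 2 * (geodesicCurvature m x y s ^ 2 + (l ^ 2 - 4 * m)) :=
    (isOpenMap_eval 0).nhds_le p hode
  linear_combination sq_add_eq_zero_of_deriv_sq_eq (pow_ne_zero 2 hl)
    (hκ.differentiableAt (by simp)) (hκ' hp) hsecond hode' hκ0

lemma IsBaseCurve.hopfFrame_mulVec_eq_zero_iff (hγ : IsBaseCurve m I x y) (hp : p 0 ∈ I)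
    {z : Fin 3 → ℝ} : hopfFrame m l x y p *ᵥ z = 0 ↔ z = 0 := by
  refine ⟨fun h => ?_, fun h => by rw [h, mulVec_zero]⟩
  rw [← dotProduct_self_eq_zero, ← hγ.hopfFrame_orthonormal (l := l) hp, h]
  simp

lemma sq_lt_four_mul_of_admits (hl : l ≠ 0)
    (h : AdmitsProperBiharmonicConformalHopfCylinder m l) : l ^ 2 < 4 * m := by
  obtain ⟨I, x, y, U, f, h⟩ := h
  have hγ := h.baseCurve
  have hf {p} (hp : p ∈ U) : ∀ᶠ q in 𝓝 p, ContDiffAt ℝ ∞ f q ∧ f q ≠ 0 := by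
    filter_upwards [h.isOpen.mem_nhds hp] with q hq
    exact ⟨h.smooth.contDiffAt (h.isOpen.mem_nhds hq), (h.pos q hq).ne'⟩
  have hbitension {p} (hp : p ∈ U) :
      bitensionComponents m l x y (fun q => f q * geodesicCurvature m x y (q 0)) p = 0 := by
    have hzero : bitension (conformalMetric m l x y f) (bcvMetric m l) (hopfCylinder x y) p = 0 :=
      h.properBiharmonic.1 p hp
    rwa [hγ.bitension_conformalMetric (h.subset hp) (hf hp),
      hγ.hopfFrame_mulVec_eq_zero_iff (h.subset hp),
      smul_eq_zero_iff_right (h.pos p hp).ne'] at hzero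
  obtain ⟨p, hp, htension⟩ : ∃ p ∈ U, tension (conformalMetric m l x y f) (bcvMetric m l)
      (hopfCylinder x y) p ≠ 0 := by
    by_contra! hharmonic
    exact h.properBiharmonic.2 hharmonic
  have hw0 : f p * geodesicCurvature m x y (p 0) ≠ 0 := by
    rw [hγ.tension_conformalMetric (h.subset hp)
      ((hf hp).self_of_nhds.1.differentiableAt (by simp)) (h.pos p hp).ne', Ne,
      hγ.hopfFrame_mulVec_eq_zero_iff (h.subset hp)] at htension
    exact fun h0 => htension (by simp [h0])
  have hκ0 := right_ne_zero_of_mul hw0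
  have hw := hγ.eventually_contDiffAt_mul_geodesicCurvature (h.subset hp)
    ((hf hp).mono fun _ => And.left)
  have hκ := hγ.geodesicCurvature_sq (h.subset hp) hl hw
    ((h.isOpen.eventually_mem hp).mono fun _ => hbitension) hw0 hκ0
  linarith [sq_pos_of_ne_zero hκ0]

end Rigidity

end BCV

theorem mainTheorem12 (m l : ℝ) :
    (BCV.AdmitsProperBiharmonicConformalHopfCylinder m l →
      BCV.IsS2R m l ∨ BCV.IsH2R m l ∨ BCV.IsR3 m l ∨ BCV.IsSU2 m l) ∧
    (BCV.IsS3 m l ∨ BCV.IsSL2 m l ∨ BCV.IsNil m l →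
      ¬ BCV.AdmitsProperBiharmonicConformalHopfCylinder m l) := by
  constructor
  · intro h
    rcases eq_or_ne l 0 with hl | hl
    · rcases lt_trichotomy m 0 with hm | hm | hm
      · exact .inr (.inl ⟨hm, hl⟩)
      · exact .inr (.inr (.inl ⟨hm, hl⟩))
      · exact .inl ⟨hm, hl⟩
    · have hlm := BCV.sq_lt_four_mul_of_admits hl h
      exact .inr (.inr (.inr ⟨by linarith [sq_nonneg l], hl, hlm.ne⟩))
  · rintro (⟨hm, hlm⟩ | ⟨hm, hl⟩ | ⟨hm, hl⟩) h
    · have hl : l ≠ 0 := by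
        rintro rfl
        linarith
      exact (BCV.sq_lt_four_mul_of_admits hl h).ne hlm
    · linarith [BCV.sq_lt_four_mul_of_admits hl h, sq_nonneg l]
    · linarith [BCV.sq_lt_four_mul_of_admits hl h, sq_nonneg l]
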